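/- Let $d\ge 1$, $1<p<q<\infty$, $0\le\alpha<d$, $0<\lambda<1$, and let $\varepsilon:[1,\infty)\to(0,\infty)$ be nondecreasing with $\sum_{r=0}^\infty \varepsilon(2^r)^{-1}<\infty$. Cubes are cubes in $\mathbb R^d$ with sides parallel to the axes, taken half-open; $|Q|$ is Lebesgue measure and $\langle f\rangle_Q=\frac1{|Q|}\int_Q f$. A family $\mathcal S$ of cubes, any two of which are nested or disjoint and in which every cube of $\mathcal S$ properly contained in a cube $Q_0\in\mathcal S$ lies in a maximal such cube (for instance, any subfamily of a dyadic grid), is called $\lambda$-sparse if for every $Q_0\in\mathcal S$ $$\sum_{Q\in\mathcal S,\;Q\subsetneq Q_0,\;Q\text{ maximal}}|Q|\le\lambda|Q_0| .$$ Put $T_{\alpha,\mathcal S}f=\sum_{Q\in\mathcal S}|Q|^{\alpha/d}\langle|f|\rangle_Q\mathbf 1_Q$. A weight is a nonnegative locally integrable function $w$ on $\mathbb R^d$, and $w(Q)=\int_Q w$. Let $Mf(x)=\sup_{Q\ni x}\langle |f|\rangle_Q$, the supremum being over all cubes containing $x$, and for a weight $\sigma$ let $\rho(Q;\sigma)=\frac1{\sigma(Q)}\int_Q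 M(\sigma\mathbf 1_Q)\in[1,\infty]$. Then there is a constant $C<\infty$ depending only on $d,p,q,\alpha,\lambda,\varepsilon$ such that for every $\lambda$-sparse family $\mathcal S$, all weights $\sigma,w$ and all $f\in L^p(\sigma)$, $$\|T_{\alpha,\mathcal S}(\sigma f)\|_{L^q(w)}\le C\,(\mathcal E+\mathcal E_*)\,\|f\|_{L^p(\sigma)},$$ where, with $\frac1p+\frac1{p'}=1$ and suprema over all cubes $Q$, $$\mathcal E=\sup_Q\frac{w(Q)^{1/q}\sigma(Q)^{1/p'}}{|Q|^{1-\alpha/d}}\bigl(\rho(Q;\sigma)\,\varepsilon(\rho(Q;\sigma))\bigr)^{1/q},\qquad \mathcal E_*=\sup_Q\frac{w(Q)^{1/q}\sigma(Q)^{1/p'}}{|Q|^{1-\alpha/d}}\bigl(\rho(Q;w)\,\varepsilon(\rho(Q;w))\bigr)^{1/p'} .$$ Here $\rho\,\varepsilon(\rho)=\infty$ if $\rho=\infty$, and cubes with $\sigma(Q)w(Q)=0$ contribute $0$ to both suprema. -/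

import Mathlib

open MeasureTheory
open scoped ENNReal NNReal

noncomputable section

namespace EntropyBump

/-- A cube of `ℝ^d` with sides parallel to the axes, given by its lower corner and its side length. -/
structure Cube (d : ℕ) where
  corner : Fin d → ℝ
  side : ℝ
  side_pos : 0 < side

/-- The underlying (half-open) point set of a cube. -/
def Cube.toSet {d : ℕ} (Q : Cube d) : Set (Fin d → ℝ) :=
  Set.univ.pi fun i => Set.Ico (Q.corner i) (Q.corner i + Q.side)

/-- The Lebesgue measure `|Q|`. -/
def Cube.vol {d : ℕ} (Q : Cube d) : ℝ≥0∞ := volume Q.toSet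

/-- The average `⟨|f|⟩_Q`. -/
def avg {d : ℕ} (f : (Fin d → ℝ) → ℝ) (Q : Cube d) : ℝ≥0∞ :=
  (∫⁻ x in Q.toSet, ‖f x‖ₑ) / Q.vol

/-- The maximal elements of `{Q ∈ S : Q ⊊ Q₀}` with respect to inclusion. -/
def maximalSubcubes {d : ℕ} (S : Set (Cube d)) (Q₀ : Cube d) : Set (Cube d) :=
  {Q | Q ∈ S ∧ Q.toSet ⊂ Q₀.toSet ∧
    ∀ P ∈ S, P.toSet ⊂ Q₀.toSet → Q.toSet ⊆ P.toSet → P.toSet = Q.toSet}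

/-- `lam`-sparse families of cubes. The fields `nested` and `exists_maximal` hold for every
subfamily of a dyadic grid; they are all that is kept of the dyadic structure. -/
structure IsSparse {d : ℕ} (lam : ℝ) (S : Set (Cube d)) : Prop where
  pos : 0 < lam
  lt_one : lam < 1
  nested : ∀ Q ∈ S, ∀ P ∈ S, Q.toSet ⊆ P.toSet ∨ P.toSet ⊆ Q.toSet ∨ Disjoint Q.toSet P.toSet
  exists_maximal : ∀ Q₀ ∈ S, ∀ Q ∈ S, Q.toSet ⊂ Q₀.toSet →
    ∃ P ∈ maximalSubcubes S Q₀, Q.toSet ⊆ P.toSet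
  sum_le : ∀ Q₀ ∈ S, ∑' Q : maximalSubcubes S Q₀, (Q : Cube d).vol ≤ ENNReal.ofReal lam * Q₀.vol

/-- The sparse operator `T_{α,S} f = ∑_{Q ∈ S} |Q|^{α/d} ⟨|f|⟩_Q 1_Q`. -/
def sparseOp {d : ℕ} (α : ℝ) (S : Set (Cube d)) (f : (Fin d → ℝ) → ℝ) (x : Fin d → ℝ) : ℝ≥0∞ :=
  ∑' Q : S, (Q : Cube d).toSet.indicator
    (fun _ => (Q : Cube d).vol ^ (α / d) * avg f (Q : Cube d)) x

/-- A weight: a nonnegative locally integrable function. -/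
structure IsWeight {d : ℕ} (w : (Fin d → ℝ) → ℝ) : Prop where
  nonneg : ∀ x, 0 ≤ w x
  locallyIntegrable : LocallyIntegrable w volume

/-- The measure `w dx`. -/
def weightMeasure {d : ℕ} (w : (Fin d → ℝ) → ℝ) : Measure (Fin d → ℝ) :=
  volume.withDensity fun x => ENNReal.ofReal (w x)

/-- The Hardy–Littlewood maximal function over all cubes containing the point. -/
def maximalFunction {d : ℕ} (f : (Fin d → ℝ) → ℝ) (x : Fin d → ℝ) : ℝ≥0∞ :=
  ⨆ (Q : Cube d) (_ : x ∈ Q.toSet), avg f Q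

/-- The local `A_∞` characteristic `ρ(Q; σ) = σ(Q)⁻¹ ∫_Q M(σ 1_Q)`; it may be infinite. -/
def localChar {d : ℕ} (Q : Cube d) (σ : (Fin d → ℝ) → ℝ) : ℝ≥0∞ :=
  (∫⁻ x in Q.toSet, maximalFunction (Q.toSet.indicator σ) x) / weightMeasure σ Q.toSet

/-- `ρ ε(ρ)`, which is infinite for `ρ = ∞`. -/
def bump (ε : ℝ → ℝ) (ρ : ℝ≥0∞) : ℝ≥0∞ :=
  if ρ = ⊤ then ⊤ else ρ * ENNReal.ofReal (ε ρ.toReal)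

/-- `w(Q)^{1/q} σ(Q)^{1/p'} / |Q|^{1 - α/d}`. -/
def apq {d : ℕ} (p q α : ℝ) (σ w : (Fin d → ℝ) → ℝ) (Q : Cube d) : ℝ≥0∞ :=
  weightMeasure w Q.toSet ^ (1 / q) * weightMeasure σ Q.toSet ^ (1 / p.conjExponent) /
    Q.vol ^ (1 - α / d)

/-- The entropy bump constant `𝓔`. -/
def entropyConst {d : ℕ} (p q α : ℝ) (ε : ℝ → ℝ) (σ w : (Fin d → ℝ) → ℝ) : ℝ≥0∞ :=
  ⨆ Q : Cube d, apq p q α σ w Q * bump ε (localChar Q σ) ^ (1 / q)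

/-- The dual entropy bump constant `𝓔_*`. -/
def entropyConstStar {d : ℕ} (p q α : ℝ) (ε : ℝ → ℝ) (σ w : (Fin d → ℝ) → ℝ) : ℝ≥0∞ :=
  ⨆ Q : Cube d, apq p q α σ w Q * bump ε (localChar Q w) ^ (1 / p.conjExponent)

end EntropyBump

end

open MeasureTheory
open scoped ENNReal NNReal

noncomputable section

namespace EntropyBump

open scoped Classical

/-! By monotone convergence and duality it suffices to bound, over finite subfamilies and for
normalized `f` and `g`, the form `∑ a(Q) ∫_Q f dσ ∫_Q g dw` with `a(Q) = |Q|^{α/d - 1}`. Sparseness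
and `α < d` make `a` decay geometrically along inclusions. Cubes are sorted by which of `⟨f⟩_Q^p
σ(Q)` and `⟨g⟩_Q^{q'} w(Q)` is larger, where averages are taken in the respective measures. The two
halves are exchanged by swapping `(p, σ, f)` with `(q', w, g)`; one is controlled by `𝓔`, the other
by `𝓔_*`.

Where `f` dominates, a testing condition on the `σ` side alone suffices (`bilinear_le_of_testing`).
Stopping cubes are chosen from the averages of `f` only. Inside each corona, `g` is replaced by its
averages on the stopping children, and domination together with the Carleson embedding for `f` makes
the resulting norms summable. Hölder and `1/p + 1/q' ≥ 1` then sum the coronas.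

The testing condition follows from the bump (`testing`). Because `p < q`, there is a gain `δ = 1/p -
1/q > 0`: along the chain of cubes through a point, `∑ a(Q) σ(Q)` is at most a constant times the
largest `a(Q) σ(Q)^{1-δ} σ(R)^δ` (`sum_mul_le_of_geometric`). The maximum is replaced by an `ℓ^q`
sum and integrated, and the bump condition leaves `∑_{Q ⊆ R} σ(Q) / B(Q)` with `B = ρ ε(ρ)`. This is
at most a constant times `σ(R)` (`sum_measure_div_le`): the layer `ρ ≈ 2^r` is `σ`-Carleson with
constant of order `2^r`, division by `B` leaves `1 / ε(2^r)`, and these are summable. -/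

/-! ### Sums of geometrically separated numbers -/

/-- A finite family of numbers below `D`, any two of which have ratio at most `κ < 1`, sums to at
most `D / (1 - κ)`. -/
theorem sum_le_of_geometric {ι : Type*} {κ : ℝ≥0∞} (hκ : κ < 1) (b : ι → ℝ≥0∞) (T : Finset ι) :
    ∀ D : ℝ≥0∞, D ≠ ⊤ → (∀ i ∈ T, b i ≤ D) →
      (∀ i ∈ T, ∀ j ∈ T, i ≠ j → b i ≤ κ * b j ∨ b j ≤ κ * b i) →
      ∑ i ∈ T, b i ≤ D * (1 - κ)⁻¹ := by
  induction T using Finset.strongInduction with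
  | H T ih =>
    intro D hD hb hgeo
    rcases T.eq_empty_or_nonempty with rfl | hT
    · simp
    -- All other members are at most `κ` times the largest one, so the induction hypothesis applies
    -- to them with `κ * D` in place of `D`.
    obtain ⟨m, hm, hmax⟩ := T.exists_max_image b hT
    rw [← Finset.add_sum_erase T b hm]
    have hbm : b m ≠ ⊤ := ne_top_of_le_ne_top hD (hb m hm)
    have key : ∀ i ∈ T.erase m, b i ≤ κ * D := by
      intro i hi
      have hne := (Finset.mem_erase.1 hi).1
      have hiT := (Finset.mem_erase.1 hi).2
      have h1 : b i ≤ κ * b m := by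
        rcases hgeo i hiT m hm hne with h | h
        · exact h
        · have h2 : b m ≤ κ * b m := h.trans (by gcongr; exact hmax i hiT)
          have h3 : b m = 0 := by
            by_contra h0
            have : κ * b m < 1 * b m := ENNReal.mul_lt_mul_left h0 hbm hκ
            rw [one_mul] at this
            exact absurd h2 (not_le.2 this)
          have := hmax i hiT
          rw [h3] at this ⊢
          simpa using this
      exact h1.trans (by gcongr; exact hb m hm)
    have h := ih (T.erase m) (Finset.erase_ssubset hm) (κ * D)
      (ENNReal.mul_ne_top (hκ.trans ENNReal.one_lt_top).ne hD) key
      (fun i hi j hj hij => hgeo i (Finset.mem_of_mem_erase hi) j (Finset.mem_of_mem_erase hj) hij)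
    have h1κ : 1 - κ ≠ 0 := (tsub_pos_of_lt hκ).ne'
    have h1κ' : 1 - κ ≠ ⊤ := (lt_of_le_of_lt tsub_le_self ENNReal.one_lt_top).ne
    calc b m + ∑ i ∈ T.erase m, b i ≤ D + κ * D * (1 - κ)⁻¹ := add_le_add (hb m hm) h
      _ = D * ((1 - κ) * (1 - κ)⁻¹) + κ * D * (1 - κ)⁻¹ := by
          rw [ENNReal.mul_inv_cancel h1κ h1κ', mul_one]
      _ = D * ((1 - κ) + κ) * (1 - κ)⁻¹ := by ring
      _ = D * (1 - κ)⁻¹ := by rw [tsub_add_cancel_of_le hκ.le, mul_one]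

/-- The constant of `sum_mul_le_of_geometric`. -/
def chainConst (κ : ℝ≥0∞) (δ : ℝ) : ℝ≥0∞ :=
  (1 - κ)⁻¹ + (1 - κ ^ (δ * (1 - δ)⁻¹))⁻¹

theorem inv_one_sub_ne_top {κ : ℝ≥0∞} (hκ : κ < 1) : (1 - κ)⁻¹ ≠ ⊤ :=
  ENNReal.inv_ne_top.2 (tsub_pos_of_lt hκ).ne'

theorem chainConst_ne_top {κ : ℝ≥0∞} (hκ : κ < 1) {δ : ℝ} (hδ : 0 < δ) (hδ1 : δ < 1) :
    chainConst κ δ ≠ ⊤ := by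
  have h : 0 < δ * (1 - δ)⁻¹ := mul_pos hδ (inv_pos.2 (by linarith))
  exact ENNReal.add_ne_top.2 ⟨inv_one_sub_ne_top hκ,
    inv_one_sub_ne_top (ENNReal.rpow_lt_one hκ h)⟩

/-- The factor `s₀ ^ δ` in the bound `D` is the gain that sums the chain without monotonicity of `a
i * s i`: when `a i` is large, the bound forces `s i` to be so small that `a i * s i` decays
geometrically as well. -/
theorem sum_mul_le_of_geometric {ι : Type*} {κ : ℝ≥0∞} (hκ : κ < 1) {δ : ℝ} (hδ : 0 < δ)
    (hδ1 : δ < 1) (a s : ι → ℝ≥0∞) (s₀ D : ℝ≥0∞) (T : Finset ι)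
    (hs₀ : s₀ ≠ 0) (hs₀' : s₀ ≠ ⊤) (ha : ∀ i ∈ T, a i ≠ 0) (ha' : ∀ i ∈ T, a i ≠ ⊤)
    (hs : ∀ i ∈ T, s i ≤ s₀)
    (hgeo : ∀ i ∈ T, ∀ j ∈ T, i ≠ j → a i ≤ κ * a j ∨ a j ≤ κ * a i)
    (hD : ∀ i ∈ T, a i * s i ^ (1 - δ) * s₀ ^ δ ≤ D) :
    ∑ i ∈ T, a i * s i ≤ chainConst κ δ * D := by
  have hone : (1 : ℝ≥0∞) ≤ (1 - κ)⁻¹ := ENNReal.one_le_inv.2 tsub_le_self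
  rcases eq_or_ne D ⊤ with rfl | hDt
  · rw [ENNReal.mul_top]
    · exact le_top
    · exact (lt_of_lt_of_le one_pos (hone.trans le_self_add)).ne'
  have hβ : 0 < δ * (1 - δ)⁻¹ := mul_pos hδ (inv_pos.2 (by linarith))
  set γ := δ * (1 - δ)⁻¹ with hγ
  -- The sum is cut where `a i * s₀` crosses `D`. Below, `s i ≤ s₀` leaves a geometric series with
  -- top at most `D`. Above, `hD` reads `(s i / s₀) ^ (1 - δ) ≤ D / (a i * s₀)`, and raising it to
  -- the power `γ = δ / (1 - δ)` gives `a i * s i ≤ D * (D / (a i * s₀)) ^ γ`, a geometric series of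
  -- ratio `κ ^ γ`.
  rw [← Finset.sum_filter_add_sum_filter_not T (fun i => a i * s₀ ≤ D), chainConst, add_mul]
  refine add_le_add ?_ ?_
  · calc ∑ i ∈ T with a i * s₀ ≤ D, a i * s i ≤ ∑ i ∈ T with a i * s₀ ≤ D, a i * s₀ := by
          refine Finset.sum_le_sum fun i hi => ?_
          gcongr
          exact hs i (Finset.mem_filter.1 hi).1
      _ ≤ D * (1 - κ)⁻¹ := by
          refine sum_le_of_geometric hκ _ _ D hDt (fun i hi => (Finset.mem_filter.1 hi).2) ?_
          intro i hi j hj hij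
          rcases hgeo i (Finset.mem_filter.1 hi).1 j (Finset.mem_filter.1 hj).1 hij with h | h
          · left; rw [← mul_assoc]; gcongr
          · right; rw [← mul_assoc]; gcongr
      _ = _ := mul_comm _ _
  · have hterm : ∀ i ∈ T, a i * s i ≤ D * (D / (a i * s₀)) ^ γ := by
      intro i hi
      have h0 : a i * s₀ ≠ 0 := mul_ne_zero (ha i hi) hs₀
      have ht : a i * s₀ ≠ ⊤ := ENNReal.mul_ne_top (ha' i hi) hs₀'
      have hsi : s i ≠ ⊤ := ne_top_of_le_ne_top hs₀' (hs i hi)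
      have e1 : a i * s i = (a i * s i ^ (1 - δ) * s₀ ^ δ) * (s i / s₀) ^ δ := by
        rw [ENNReal.div_rpow_of_nonneg _ _ hδ.le]
        have : s i = s i ^ (1 - δ) * s i ^ δ := by
          rw [← ENNReal.rpow_add_of_nonneg _ _ (by linarith) hδ.le]; simp
        have h1 : s₀ ^ δ ≠ 0 := by simp [hs₀, hs₀']
        have h2 : s₀ ^ δ ≠ ⊤ := by simp [hs₀', hδ.le]
        calc a i * s i = a i * (s i ^ (1 - δ) * s i ^ δ) := by rw [← this]
          _ = a i * (s i ^ (1 - δ) * s i ^ δ) * (s₀ ^ δ * (s₀ ^ δ)⁻¹) := by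
              rw [ENNReal.mul_inv_cancel h1 h2, mul_one]
          _ = _ := by rw [div_eq_mul_inv]; ring
      have e2 : (s i / s₀) ^ δ ≤ (D / (a i * s₀)) ^ γ := by
        have e3 : (s i / s₀) ^ δ = ((s i / s₀) ^ (1 - δ)) ^ γ := by
          rw [← ENNReal.rpow_mul]; congr 1; rw [hγ]; field_simp
          rw [div_self (by linarith)]
        rw [e3]
        refine ENNReal.rpow_le_rpow ?_ hβ.le
        rw [ENNReal.le_div_iff_mul_le (Or.inl h0) (Or.inl ht)]
        refine le_trans (le_of_eq ?_) (hD i hi)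
        rw [ENNReal.div_rpow_of_nonneg _ _ (by linarith)]
        have : s₀ = s₀ ^ (1 - δ) * s₀ ^ δ := by
          rw [← ENNReal.rpow_add_of_nonneg _ _ (by linarith) hδ.le]; simp
        have h1 : s₀ ^ (1 - δ) ≠ 0 := by simp [hs₀, hs₀']
        have h2 : s₀ ^ (1 - δ) ≠ ⊤ := by simp [hs₀', hδ1.le]
        calc s i ^ (1 - δ) / s₀ ^ (1 - δ) * (a i * s₀)
            = s i ^ (1 - δ) / s₀ ^ (1 - δ) * (a i * (s₀ ^ (1 - δ) * s₀ ^ δ)) := by rw [← this]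
          _ = a i * s i ^ (1 - δ) * s₀ ^ δ * (s₀ ^ (1 - δ) * (s₀ ^ (1 - δ))⁻¹) := by
              rw [div_eq_mul_inv]; ring
          _ = _ := by rw [ENNReal.mul_inv_cancel h1 h2, mul_one]
      rw [e1]
      gcongr
      exact hD i hi
    calc ∑ i ∈ T with ¬ a i * s₀ ≤ D, a i * s i
        ≤ ∑ i ∈ T with ¬ a i * s₀ ≤ D, D * (D / (a i * s₀)) ^ γ :=
          Finset.sum_le_sum fun i hi => hterm i (Finset.mem_filter.1 hi).1
      _ = D * ∑ i ∈ T with ¬ a i * s₀ ≤ D, (D / (a i * s₀)) ^ γ := by rw [Finset.mul_sum]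
      _ ≤ D * (1 * (1 - κ ^ γ)⁻¹) := by
          gcongr
          have aux : ∀ i ∈ T, ∀ j ∈ T, a i ≤ κ * a j →
              (D / (a j * s₀)) ^ γ ≤ κ ^ γ * (D / (a i * s₀)) ^ γ := by
            intro i hi j hj h
            rw [← ENNReal.mul_rpow_of_nonneg _ _ hβ.le]
            refine ENNReal.rpow_le_rpow ?_ hβ.le
            have hj0 : a j * s₀ ≠ 0 := mul_ne_zero (ha j hj) hs₀
            have hjt : a j * s₀ ≠ ⊤ := ENNReal.mul_ne_top (ha' j hj) hs₀'
            have hi0 : a i * s₀ ≠ 0 := mul_ne_zero (ha i hi) hs₀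
            have hit : a i * s₀ ≠ ⊤ := ENNReal.mul_ne_top (ha' i hi) hs₀'
            rw [ENNReal.div_le_iff hj0 hjt]
            calc D = D * ((a i * s₀)⁻¹ * (a i * s₀)) := by
                    rw [ENNReal.inv_mul_cancel hi0 hit, mul_one]
              _ ≤ D * ((a i * s₀)⁻¹ * (κ * a j * s₀)) := by gcongr
              _ = κ * (D / (a i * s₀)) * (a j * s₀) := by rw [div_eq_mul_inv]; ring
          refine sum_le_of_geometric (ENNReal.rpow_lt_one hκ hβ) _ _ 1 (by simp) ?_ ?_
          · intro i hi
            refine ENNReal.rpow_le_one ?_ hβ.le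
            exact ENNReal.div_le_of_le_mul (by
              rw [one_mul]; exact (not_le.1 (Finset.mem_filter.1 hi).2).le)
          · intro i hi j hj hij
            rcases hgeo i (Finset.mem_filter.1 hi).1 j (Finset.mem_filter.1 hj).1 hij with h | h
            · right; exact aux i (Finset.mem_filter.1 hi).1 j (Finset.mem_filter.1 hj).1 h
            · left; exact aux j (Finset.mem_filter.1 hj).1 i (Finset.mem_filter.1 hi).1 h
      _ = _ := by rw [one_mul, mul_comm]

/-! ### Nested families and the testing condition -/

/-- A finite family of measurable sets, any two of which are nested or disjoint. -/
structure IsNested {X : Type*} [MeasurableSpace X] (S : Finset (Set X)) : Prop where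
  measurableSet : ∀ Q ∈ S, MeasurableSet Q
  nested : ∀ Q ∈ S, ∀ P ∈ S, Q ⊆ P ∨ P ⊆ Q ∨ Disjoint Q P

section Nested

variable {X : Type*} [MeasurableSpace X] {S : Finset (Set X)}

theorem IsNested.mono (hS : IsNested S) {S' : Finset (Set X)} (h : S' ⊆ S) : IsNested S' :=
  ⟨fun Q hQ => hS.measurableSet Q (h hQ), fun Q hQ P hP => hS.nested Q (h hQ) P (h hP)⟩

theorem IsNested.ssubset_or_ssubset (hS : IsNested S) {P Q : Set X} (hP : P ∈ S) (hQ : Q ∈ S)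
    (hne : P ≠ Q) {x : X} (hxP : x ∈ P) (hxQ : x ∈ Q) : P ⊂ Q ∨ Q ⊂ P := by
  rcases hS.nested P hP Q hQ with h | h | h
  · exact Or.inl (h.ssubset_of_ne hne)
  · exact Or.inr (h.ssubset_of_ne hne.symm)
  · exact absurd hxQ (Set.disjoint_left.1 h hxP)

/-- In a nested family the set of members containing a point is a chain, so a geometric dependence
along proper inclusions is a geometric dependence between any two of its members. -/
theorem IsNested.geometric (hS : IsNested S) {κ : ℝ≥0∞} {a : Set X → ℝ≥0∞}
    (hgeo : ∀ P ∈ S, ∀ Q ∈ S, P ⊂ Q → a Q ≤ κ * a P) (x : X) :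
    ∀ P ∈ S.filter (x ∈ ·), ∀ Q ∈ S.filter (x ∈ ·), P ≠ Q → a P ≤ κ * a Q ∨ a Q ≤ κ * a P := by
  intro P hP Q hQ hne
  rw [Finset.mem_filter] at hP hQ
  rcases hS.ssubset_or_ssubset hP.1 hQ.1 hne hP.2 hQ.2 with h | h
  · exact Or.inr (hgeo P hP.1 Q hQ.1 h)
  · exact Or.inl (hgeo Q hQ.1 P hP.1 h)

theorem sum_indicator_eq_sum_filter {X : Type*} (S : Finset (Set X)) (c : Set X → ℝ≥0∞) (x : X) :
    ∑ Q ∈ S, Q.indicator (fun _ => c Q) x = ∑ Q ∈ S with x ∈ Q, c Q := by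
  rw [Finset.sum_filter]
  refine Finset.sum_congr rfl fun Q _ => ?_
  simp [Set.indicator_apply]

theorem lintegral_sum_indicator (hS : ∀ Q ∈ S, MeasurableSet Q) (μ : Measure X)
    (c : Set X → ℝ≥0∞) :
    ∫⁻ x, ∑ Q ∈ S, Q.indicator (fun _ => c Q) x ∂μ = ∑ Q ∈ S, c Q * μ Q := by
  rw [lintegral_finsetSum' _ fun Q hQ => (measurable_const.indicator (hS Q hQ)).aemeasurable]
  refine Finset.sum_congr rfl fun Q hQ => ?_
  rw [lintegral_indicator_const (hS Q hQ)]

theorem measurable_sum_indicator (hS : ∀ Q ∈ S, MeasurableSet Q) (c : Set X → ℝ≥0∞) :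
    Measurable fun x => ∑ Q ∈ S, Q.indicator (fun _ => c Q) x :=
  Finset.measurable_fun_sum _ fun Q hQ => measurable_const.indicator (hS Q hQ)

/-- A single summand is bounded by the `ℓ^q` sum. -/
theorem le_rpow_sum_rpow {ι : Type*} (T : Finset ι) (u : ι → ℝ≥0∞) {q : ℝ} (hq : 0 < q) {i : ι}
    (hi : i ∈ T) : u i ≤ (∑ j ∈ T, u j ^ q) ^ (1 / q) := by
  rw [one_div, ENNReal.le_rpow_inv_iff hq]
  exact Finset.single_le_sum (f := fun j => u j ^ q) (fun _ _ => zero_le) hi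

/-- The testing condition: a `σ`-Carleson sequence `σ(Q) / X(Q)` and the bump condition for `X`
bound the operator on indicators. -/
theorem testing {p q : ℝ} (hp : 1 < p) (hpq : p < q) {κ : ℝ≥0∞} (hκ : κ < 1)
    (hS : IsNested S) (σ w : Measure X) (a B : Set X → ℝ≥0∞) {E K : ℝ≥0∞}
    (ha : ∀ Q ∈ S, a Q ≠ 0) (ha' : ∀ Q ∈ S, a Q ≠ ⊤)
    (hgeo : ∀ P ∈ S, ∀ Q ∈ S, P ⊂ Q → a Q ≤ κ * a P)
    (hσ : ∀ Q ∈ S, σ Q ≠ 0) (hσ' : ∀ Q ∈ S, σ Q ≠ ⊤)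
    (hB : ∀ Q ∈ S, B Q ≠ 0) (hB' : ∀ Q ∈ S, B Q ≠ ⊤)
    (hE : ∀ Q ∈ S, a Q * σ Q ^ (1 - 1 / p) * w Q ^ (1 / q) * B Q ^ (1 / q) ≤ E)
    (hK : ∀ R ∈ S, ∑ Q ∈ S with Q ⊆ R, σ Q / B Q ≤ K * σ R)
    {R : Set X} (hR : R ∈ S) :
    ∫⁻ x, (∑ Q ∈ S with Q ⊆ R, Q.indicator (fun _ => a Q * σ Q) x) ^ q ∂w ≤
      (chainConst κ (1 / p - 1 / q) * E) ^ q * K * σ R ^ (q / p) := by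
  have hp0 : 0 < p := by linarith
  have hq0 : 0 < q := by linarith
  set δ := 1 / p - 1 / q with hδ
  have hδ0 : 0 < δ := sub_pos.2 (one_div_lt_one_div_of_lt hp0 hpq)
  have hδ1 : δ < 1 := by
    have : 1 / p < 1 := by rw [div_lt_one hp0]; exact hp
    have : 0 < 1 / q := by positivity
    linarith
  set C := chainConst κ δ
  have hsub : S.filter (· ⊆ R) ⊆ S := Finset.filter_subset _ _
  have hS' := hS.mono hsub
  set u : Set X → ℝ≥0∞ := fun Q => a Q * σ Q ^ (1 - δ) * σ R ^ δ with hu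
  -- The members through `x` form a chain, so the sum is controlled by the largest `u Q`. Passing to
  -- the `ℓ^q` sum makes the `q`-th power linear in the indicators, ready for integration.
  have hpt : ∀ x, (∑ Q ∈ S with Q ⊆ R, Q.indicator (fun _ => a Q * σ Q) x) ^ q ≤
      C ^ q * ∑ Q ∈ S with Q ⊆ R, Q.indicator (fun _ => u Q ^ q) x := by
    intro x
    rw [sum_indicator_eq_sum_filter, sum_indicator_eq_sum_filter]
    set T := (S.filter (· ⊆ R)).filter (x ∈ ·) with hT
    have hTS : ∀ Q ∈ T, Q ∈ S := fun Q hQ => hsub (Finset.filter_subset _ _ hQ)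
    have h := sum_mul_le_of_geometric hκ hδ0 hδ1 a (fun Q => σ Q) (σ R)
      ((∑ Q ∈ T, u Q ^ q) ^ (1 / q)) T (hσ R hR) (hσ' R hR) (fun Q hQ => ha Q (hTS Q hQ))
      (fun Q hQ => ha' Q (hTS Q hQ))
      (fun Q hQ => measure_mono (Finset.mem_filter.1 (Finset.mem_filter.1 hQ).1).2)
      (hS'.geometric (fun P hP Q hQ => hgeo P (hsub hP) Q (hsub hQ)) x)
      (fun Q hQ => le_rpow_sum_rpow T u hq0 hQ)
    calc (∑ Q ∈ T, a Q * σ Q) ^ q ≤ (C * (∑ Q ∈ T, u Q ^ q) ^ (1 / q)) ^ q :=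
          ENNReal.rpow_le_rpow h hq0.le
      _ = _ := by
          rw [ENNReal.mul_rpow_of_nonneg _ _ hq0.le, ← ENNReal.rpow_mul, one_div,
            inv_mul_cancel₀ hq0.ne', ENNReal.rpow_one]
  have hterm : ∀ Q ∈ S.filter (· ⊆ R), u Q ^ q * w Q ≤ E ^ q * σ R ^ (q * δ) * (σ Q / B Q) := by
    intro Q hQ
    have hQS := hsub hQ
    have hw : w Q = (w Q ^ (1 / q)) ^ q := by
      rw [← ENNReal.rpow_mul, one_div, inv_mul_cancel₀ hq0.ne', ENNReal.rpow_one]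
    have hBq : B Q = (B Q ^ (1 / q)) ^ q := by
      rw [← ENNReal.rpow_mul, one_div, inv_mul_cancel₀ hq0.ne', ENNReal.rpow_one]
    -- Since `q * δ = q / p - 1`, exactly one full power of `σ Q` is left over from the bump
    -- condition; it feeds the Carleson sum.
    have hσq : (σ Q ^ (1 - δ)) ^ q = (σ Q ^ (1 - 1 / p)) ^ q * σ Q := by
      rw [← ENNReal.rpow_mul, ← ENNReal.rpow_mul]
      conv_rhs => rw [← ENNReal.rpow_one (σ Q)]
      rw [← ENNReal.rpow_mul, ← ENNReal.rpow_add _ _ (hσ Q hQS) (hσ' Q hQS)]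
      congr 1
      rw [hδ]; field_simp; ring
    have e1 : u Q ^ q * w Q = (a Q * σ Q ^ (1 - 1 / p) * w Q ^ (1 / q) * B Q ^ (1 / q)) ^ q *
        σ R ^ (q * δ) * (σ Q / B Q) := by
      rw [hu]
      simp only [ENNReal.mul_rpow_of_nonneg _ _ hq0.le]
      rw [hσq, ← hw, ← hBq, ← ENNReal.rpow_mul (σ R), mul_comm δ q, div_eq_mul_inv (σ Q)]
      calc a Q ^ q * ((σ Q ^ (1 - 1 / p)) ^ q * σ Q) * σ R ^ (q * δ) * w Q
          = a Q ^ q * ((σ Q ^ (1 - 1 / p)) ^ q * σ Q) * σ R ^ (q * δ) * w Q *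
            (B Q * (B Q)⁻¹) := by
            rw [ENNReal.mul_inv_cancel (hB Q hQS) (hB' Q hQS), mul_one]
        _ = _ := by ring
    rw [e1]
    gcongr
    exact hE Q hQS
  calc ∫⁻ x, (∑ Q ∈ S with Q ⊆ R, Q.indicator (fun _ => a Q * σ Q) x) ^ q ∂w
      ≤ ∫⁻ x, C ^ q * ∑ Q ∈ S with Q ⊆ R, Q.indicator (fun _ => u Q ^ q) x ∂w :=
        lintegral_mono hpt
    _ = C ^ q * ∑ Q ∈ S with Q ⊆ R, u Q ^ q * w Q := by
        rw [lintegral_const_mul _ (measurable_sum_indicator hS'.measurableSet _),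
          lintegral_sum_indicator hS'.measurableSet]
    _ ≤ C ^ q * ∑ Q ∈ S with Q ⊆ R, E ^ q * σ R ^ (q * δ) * (σ Q / B Q) := by
        gcongr C ^ q * ?_
        exact Finset.sum_le_sum hterm
    _ = C ^ q * (E ^ q * σ R ^ (q * δ) * ∑ Q ∈ S with Q ⊆ R, (σ Q / B Q)) := by
        rw [← Finset.mul_sum]
    _ ≤ C ^ q * (E ^ q * σ R ^ (q * δ) * (K * σ R)) := by
        gcongr
        exact hK R hR
    _ = (C * E) ^ q * K * (σ R ^ (q * δ) * σ R ^ (1 : ℝ)) := by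
        rw [ENNReal.mul_rpow_of_nonneg _ _ hq0.le, ENNReal.rpow_one]; ring
    _ = _ := by
        rw [← ENNReal.rpow_add _ _ (hσ R hR) (hσ' R hR)]
        congr 2
        rw [hδ]; field_simp; ring

end Nested

/-! ### Carleson embedding and principal members -/

section Principal

variable {X : Type*} [MeasurableSpace X] {S : Finset (Set X)}

/-- Absorption: the factor `L ^ (1 / p')` is cancelled, which is legitimate only because `L` is
finite. It closes both the Carleson embedding and the converse of Hölder. -/
theorem le_rpow_of_le_mul_rpow {p p' : ℝ} (hpp : p.HolderConjugate p') {L A : ℝ≥0∞} (hL : L ≠ ⊤)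
    (h : L ≤ A * L ^ (1 / p')) : L ≤ A ^ p := by
  rcases eq_or_ne L 0 with rfl | h0
  · simp
  have e : L = L ^ (1 / p) * L ^ (1 / p') := by
    rw [← ENNReal.rpow_add _ _ h0 hL, one_div, one_div, hpp.inv_add_inv_eq_one, ENNReal.rpow_one]
  have h1 : L ^ (1 / p') ≠ 0 := by simp [h0, hL]
  have h2 : L ^ (1 / p') ≠ ⊤ := by simp [h0, hL]
  have h3 : L ^ (1 / p) * L ^ (1 / p') ≤ A * L ^ (1 / p') := by rwa [← e]
  have h4 : L ^ (1 / p) ≤ A := (ENNReal.mul_le_mul_iff_left h1 h2).1 h3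
  rwa [one_div, ENNReal.rpow_inv_le_iff hpp.pos] at h4

/-- The Carleson embedding for a family whose averages grow geometrically along inclusions. -/
theorem sum_rpow_mul_measure_le {p p' : ℝ} (hpp : p.HolderConjugate p') (hS : IsNested S)
    (σ : Measure X) {f : X → ℝ≥0∞} (hf : Measurable f) (b : Set X → ℝ≥0∞)
    (hb : ∀ F ∈ S, b F ≠ ⊤) (hσ : ∀ F ∈ S, σ F ≠ ⊤)
    (hgeo : ∀ P ∈ S, ∀ Q ∈ S, P ⊂ Q → b Q ≤ 2⁻¹ * b P)
    (hbf : ∀ F ∈ S, b F * σ F ≤ ∫⁻ x in F, f x ∂σ) :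
    ∑ F ∈ S, b F ^ p * σ F ≤ (1 - (2⁻¹ : ℝ≥0∞) ^ (p - 1))⁻¹ ^ p * ∫⁻ x, f x ^ p ∂σ := by
  have hp1 : 0 < p - 1 := hpp.sub_one_pos
  have hp0 : 0 < p := hpp.pos
  have hp'0 : 0 < p' := hpp.symm.pos
  set κ : ℝ≥0∞ := 2⁻¹ ^ (p - 1) with hκdef
  have hκ : κ < 1 := ENNReal.rpow_lt_one ENNReal.one_half_lt_one hp1
  set C := (1 - κ)⁻¹ with hC
  set L := ∑ F ∈ S, b F ^ p * σ F with hLdef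
  have hL : L ≠ ⊤ := ENNReal.sum_ne_top.2 fun F hF =>
    ENNReal.mul_ne_top (ENNReal.rpow_ne_top_of_nonneg hp0.le (hb F hF)) (hσ F hF)
  -- `G` is the dualizing function. Its values at a point are sums of geometrically separated terms
  -- and `(p - 1) * p' = p`, so its `L^{p'}` norm is at most `C * L ^ (1 / p')`; also `L ≤ ∫ f G
  -- dσ`. Hölder and absorption finish.
  set G : X → ℝ≥0∞ := fun x => ∑ F ∈ S, F.indicator (fun _ => b F ^ (p - 1)) x with hG
  have hGm : Measurable G := measurable_sum_indicator hS.measurableSet _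
  have hpow : ∀ F, (b F ^ (p - 1)) ^ p' = b F ^ p := by
    intro F
    rw [← ENNReal.rpow_mul, hpp.sub_one_mul_conj]
  have hGpt : ∀ x, G x ^ p' ≤ C ^ p' * ∑ F ∈ S, F.indicator (fun _ => b F ^ p) x := by
    intro x
    rw [hG]
    simp only
    rw [sum_indicator_eq_sum_filter, sum_indicator_eq_sum_filter]
    set T := S.filter (x ∈ ·)
    have hTS : ∀ F ∈ T, F ∈ S := fun F hF => (Finset.mem_filter.1 hF).1
    have hfin : (∑ F ∈ T, (b F ^ (p - 1)) ^ p') ^ (1 / p') ≠ ⊤ := by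
      refine ENNReal.rpow_ne_top_of_nonneg (by positivity) (ENNReal.sum_ne_top.2 fun F hF => ?_)
      rw [hpow]
      exact ENNReal.rpow_ne_top_of_nonneg hp0.le (hb F (hTS F hF))
    have h := sum_le_of_geometric hκ (fun F => b F ^ (p - 1)) T _ hfin
      (fun F hF => le_rpow_sum_rpow T (fun F => b F ^ (p - 1)) hp'0 hF)
      (hS.geometric (a := fun F => b F ^ (p - 1)) (fun P hP Q hQ hPQ => by
        rw [hκdef, ← ENNReal.mul_rpow_of_nonneg _ _ hp1.le]
        exact ENNReal.rpow_le_rpow (hgeo P hP Q hQ hPQ) hp1.le) x)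
    calc (∑ F ∈ T, b F ^ (p - 1)) ^ p'
        ≤ ((∑ F ∈ T, (b F ^ (p - 1)) ^ p') ^ (1 / p') * C) ^ p' :=
          ENNReal.rpow_le_rpow h hp'0.le
      _ = C ^ p' * ∑ F ∈ T, b F ^ p := by
          rw [ENNReal.mul_rpow_of_nonneg _ _ hp'0.le, ← ENNReal.rpow_mul, one_div,
            inv_mul_cancel₀ hp'0.ne', ENNReal.rpow_one, mul_comm]
          simp only [hpow]
  have h1 : L ≤ ∫⁻ x, (f * G) x ∂σ := by
    have e : ∀ x, (f * G) x = ∑ F ∈ S, F.indicator (fun x => b F ^ (p - 1) * f x) x := by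
      intro x
      simp only [Pi.mul_apply, hG, Finset.mul_sum]
      refine Finset.sum_congr rfl fun F _ => ?_
      by_cases hx : x ∈ F <;> simp [hx, mul_comm]
    simp only [e]
    rw [lintegral_finsetSum' _ fun F hF =>
      ((hf.const_mul _).indicator (hS.measurableSet F hF)).aemeasurable]
    refine Finset.sum_le_sum fun F hF => ?_
    rw [lintegral_indicator (hS.measurableSet F hF), lintegral_const_mul _ hf]
    calc b F ^ p * σ F = b F ^ (p - 1) * (b F * σ F) := by
          rw [← mul_assoc]
          congr 1
          conv_rhs => rw [← ENNReal.rpow_one (b F), ← ENNReal.rpow_mul, one_mul]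
          rw [← ENNReal.rpow_add_of_nonneg _ _ hp1.le zero_le_one, sub_add_cancel]
      _ ≤ _ := by gcongr; exact hbf F hF
  have h2 : L ≤ ((∫⁻ x, f x ^ p ∂σ) ^ (1 / p) * C) * L ^ (1 / p') := by
    calc L ≤ ∫⁻ x, (f * G) x ∂σ := h1
      _ ≤ (∫⁻ x, f x ^ p ∂σ) ^ (1 / p) * (∫⁻ x, G x ^ p' ∂σ) ^ (1 / p') :=
          ENNReal.lintegral_mul_le_Lp_mul_Lq σ hpp hf.aemeasurable hGm.aemeasurable
      _ ≤ (∫⁻ x, f x ^ p ∂σ) ^ (1 / p) * (C ^ p' * L) ^ (1 / p') := by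
          gcongr
          calc ∫⁻ x, G x ^ p' ∂σ
              ≤ ∫⁻ x, C ^ p' * ∑ F ∈ S, F.indicator (fun _ => b F ^ p) x ∂σ :=
                lintegral_mono hGpt
            _ = C ^ p' * L := by
                rw [lintegral_const_mul _ (measurable_sum_indicator hS.measurableSet _),
                  lintegral_sum_indicator hS.measurableSet]
      _ = _ := by
          rw [ENNReal.mul_rpow_of_nonneg _ _ (by positivity), ← ENNReal.rpow_mul, one_div p',
            mul_inv_cancel₀ hp'0.ne', ENNReal.rpow_one, mul_assoc]
  refine (le_rpow_of_le_mul_rpow hpp hL h2).trans (le_of_eq ?_)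
  rw [ENNReal.mul_rpow_of_nonneg _ _ hp0.le, ← ENNReal.rpow_mul, one_div,
    inv_mul_cancel₀ hp0.ne', ENNReal.rpow_one, mul_comm]

/-- The members of `S` at which the level `ℓ` increases strictly. -/
def principal {X : Type*} (S : Finset (Set X)) (ℓ : Set X → ℤ) : Finset (Set X) :=
  S.filter fun F => ∀ P ∈ S, F ⊂ P → ℓ P < ℓ F

/-- A maximal member among those containing `Q` on the level of `Q` is principal, since by
monotonicity anything strictly larger has strictly lower level. This distributes the family into
coronas. -/
theorem exists_principal {X : Type*} {S : Finset (Set X)} {ℓ : Set X → ℤ}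
    (hℓ : ∀ P ∈ S, ∀ Q ∈ S, Q ⊆ P → ℓ P ≤ ℓ Q) {Q : Set X} (hQ : Q ∈ S) :
    ∃ F ∈ principal S ℓ, Q ⊆ F ∧ ℓ Q = ℓ F := by
  obtain ⟨F, hQF, hF⟩ := Finset.exists_le_maximal (S.filter fun P => Q ⊆ P ∧ ℓ Q = ℓ P)
    (a := Q) (by simp [hQ])
  have hF1 := Finset.mem_filter.1 hF.1
  refine ⟨F, Finset.mem_filter.2 ⟨hF1.1, fun P hP hFP => ?_⟩, hF1.2.1, hF1.2.2⟩
  refine lt_of_le_of_ne (hℓ P hP F hF1.1 hFP.subset) fun hne => ?_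
  have : P ∈ S.filter fun P => Q ⊆ P ∧ ℓ Q = ℓ P :=
    Finset.mem_filter.2 ⟨hP, hF1.2.1.trans hFP.subset, by rw [hF1.2.2, hne]⟩
  exact hFP.2 (hF.2 this hFP.subset)

/-- A dyadic level function for the running maxima of `m` along inclusions. -/
theorem exists_level {X : Type*} (S : Finset (Set X)) (m : Set X → ℝ≥0∞) (hm : ∀ Q ∈ S, m Q ≠ 0)
    (hm' : ∀ Q ∈ S, m Q ≠ ⊤) :
    ∃ ℓ : Set X → ℤ, (∀ P ∈ S, ∀ Q ∈ S, Q ⊆ P → ℓ P ≤ ℓ Q) ∧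
      (∀ Q ∈ S, m Q ≤ 2 * 2 ^ ℓ Q) ∧ ∀ F ∈ principal S ℓ, 2 ^ ℓ F ≤ m F := by
  have h0 : ∀ Q, ∃ n : ℤ, Q ∈ S → m Q ∈ Set.Ico ((2 : ℝ≥0∞) ^ n) (2 ^ (n + 1)) := by
    intro Q
    by_cases hQ : Q ∈ S
    · obtain ⟨n, hn⟩ := ENNReal.exists_mem_Ico_zpow (hm Q hQ) (hm' Q hQ) ENNReal.one_lt_two
        ENNReal.ofNat_ne_top
      exact ⟨n, fun _ => hn⟩
    · exact ⟨0, fun h => absurd h hQ⟩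
  choose n hn using h0
  -- The level of `Q` is the largest dyadic exponent of `m` among the members containing `Q`, hence
  -- monotone; the value `0` outside the family is never used.
  set ℓ : Set X → ℤ := fun Q =>
    if h : (S.filter (Q ⊆ ·)).Nonempty then (S.filter (Q ⊆ ·)).sup' h n else 0 with hℓdef
  have hne : ∀ Q ∈ S, (S.filter (Q ⊆ ·)).Nonempty := fun Q hQ => ⟨Q, by simp [hQ]⟩
  have hℓ : ∀ Q (hQ : Q ∈ S), ℓ Q = (S.filter (Q ⊆ ·)).sup' (hne Q hQ) n := fun Q hQ => by
    simp only [hℓdef, dif_pos (hne Q hQ)]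
  have hnℓ : ∀ Q ∈ S, ∀ P ∈ S, Q ⊆ P → n P ≤ ℓ Q := by
    intro Q hQ P hP hQP
    rw [hℓ Q hQ]
    exact Finset.le_sup' n (Finset.mem_filter.2 ⟨hP, hQP⟩)
  refine ⟨ℓ, ?_, ?_, ?_⟩
  · intro P hP Q hQ hQP
    rw [hℓ P hP]
    refine Finset.sup'_le _ _ fun R hR => ?_
    rw [Finset.mem_filter] at hR
    exact hnℓ Q hQ R hR.1 (hQP.trans hR.2)
  · intro Q hQ
    refine (hn Q hQ).2.le.trans ?_
    rw [mul_comm, ENNReal.zpow_add two_ne_zero ENNReal.ofNat_ne_top, zpow_one]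
    gcongr
    · exact ENNReal.one_lt_two.le
    · exact hnℓ Q hQ Q hQ subset_rfl
  · intro F hF
    have hF' := Finset.mem_filter.1 hF
    obtain ⟨P, hP, hPe⟩ := Finset.exists_mem_eq_sup' (hne F hF'.1) n
    rw [Finset.mem_filter] at hP
    rw [← hℓ F hF'.1] at hPe
    -- At a principal `F` the maximum is attained at `F` itself: a proper ancestor `P` attaining it
    -- would give `n P ≤ ℓ P < ℓ F = n P`.
    have hPF : P = F := by
      by_contra hPF
      have h1 := hF'.2 P hP.1 (hP.2.ssubset_of_ne (Ne.symm hPF))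
      have h2 := hnℓ P hP.1 P hP.1 subset_rfl
      omega
    rw [hPe, hPF]
    exact (hn F hF'.1).1

end Principal

/-! ### Corona decomposition: testing bounds the dominated bilinear form -/

section Corona

variable {X : Type*} [MeasurableSpace X] {S : Finset (Set X)}

/-- The children of `F` in the family `S`: the members whose smallest proper ancestor is `F`. -/
def children {X : Type*} (S : Finset (Set X)) (F : Set X) : Finset (Set X) :=
  S.filter fun F' => F' ⊂ F ∧ ∀ P ∈ S, F' ⊂ P → F ⊆ P

/-- The part of `F` not covered by its children. -/
def exclusive {X : Type*} (S : Finset (Set X)) (F : Set X) : Set X :=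
  F \ ⋃ F' ∈ children S F, F'

theorem IsNested.children_pairwiseDisjoint (hS : IsNested S) (F : Set X) :
    (↑(children S F) : Set (Set X)).PairwiseDisjoint id := by
  intro P hP Q hQ hne
  have hP' := Finset.mem_filter.1 (Finset.mem_coe.1 hP)
  have hQ' := Finset.mem_filter.1 (Finset.mem_coe.1 hQ)
  rw [Function.onFun, id, id, Set.disjoint_left]
  intro x hxP hxQ
  rcases hS.ssubset_or_ssubset hP'.1 hQ'.1 hne hxP hxQ with h | h
  · exact hQ'.2.1.2 (hP'.2.2 Q hQ'.1 h)
  · exact hP'.2.1.2 (hQ'.2.2 P hP'.1 h)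

theorem IsNested.measurableSet_exclusive (hS : IsNested S) {F : Set X} (hF : F ∈ S) :
    MeasurableSet (exclusive S F) :=
  (hS.measurableSet F hF).diff (Finset.measurableSet_biUnion _ fun P hP =>
    hS.measurableSet P (Finset.mem_filter.1 hP).1)

theorem IsNested.exclusive_pairwiseDisjoint (hS : IsNested S) :
    (↑S : Set (Set X)).PairwiseDisjoint (exclusive S) := by
  -- A maximal member between `P` and `Q`, proper in `Q`, is a child of `Q`; hence all of `P` is
  -- removed from the exclusive part of `Q`.
  have key : ∀ P ∈ S, ∀ Q ∈ S, P ⊂ Q → ∀ x ∈ P, x ∉ exclusive S Q := by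
    intro P hP Q hQ hPQ x hxP hx
    obtain ⟨F, hPF, hF⟩ := Finset.exists_le_maximal (S.filter fun F => P ⊆ F ∧ F ⊂ Q)
      (a := P) (by simp [hP, hPQ])
    have hF1 := Finset.mem_filter.1 hF.1
    have hxF : x ∈ F := hF1.2.1 hxP
    refine hx.2 (Set.mem_biUnion (x := F) (Finset.mem_filter.2 ⟨hF1.1, hF1.2.2, ?_⟩) hxF)
    intro R hR hFR
    by_contra hQR
    have hne : R ≠ Q := fun h => hQR (h ▸ subset_rfl)
    rcases hS.ssubset_or_ssubset hR hQ hne (hFR.subset hxF) hx.1 with h | h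
    · exact hFR.2 (hF.2 (Finset.mem_filter.2 ⟨hR, hF1.2.1.trans hFR.subset, h⟩) hFR.subset)
    · exact hQR h.subset
  intro P hP Q hQ hne
  rw [Function.onFun, Set.disjoint_left]
  intro x hxP hxQ
  rcases hS.ssubset_or_ssubset hP hQ hne hxP.1 hxQ.1 with h | h
  · exact key P hP Q hQ h x hxP.1 hxQ
  · exact key Q hQ P hP h x hxQ.1 hxP

/-- Two members having the same child contain each other, so each child is counted once. -/
theorem sum_children_le {X : Type*} (S : Finset (Set X)) (c : Set X → ℝ≥0∞) :
    ∑ F ∈ S, ∑ F' ∈ children S F, c F' ≤ ∑ F ∈ S, c F := by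
  simp only [children, Finset.sum_filter]
  rw [Finset.sum_comm]
  refine Finset.sum_le_sum fun F' hF' => ?_
  rw [← Finset.sum_filter, Finset.sum_const]
  refine (nsmul_le_nsmul_left zero_le (m := 1) (Finset.card_le_one.2 ?_)).trans (by simp)
  intro P hP Q hQ
  rw [Finset.mem_filter] at hP hQ
  exact (hP.2.2 Q hQ.1 hQ.2.1).antisymm (hQ.2.2 P hP.1 hP.2.1)

/-- The function `g` on the exclusive part of `F`, and its averages on the children of `F`. -/
def coronaFun {X : Type*} (S : Finset (Set X)) (r : ℝ) (c : Set X → ℝ≥0∞) (g : X → ℝ≥0∞)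
    (F : Set X) (x : X) : ℝ≥0∞ :=
  ((exclusive S F).indicator (fun x => g x ^ r) x +
    ∑ F' ∈ children S F, F'.indicator (fun _ => c F' ^ r) x) ^ (1 / r)

theorem IsNested.measurable_coronaFun (hS : IsNested S) {r : ℝ} (c : Set X → ℝ≥0∞)
    {g : X → ℝ≥0∞} (hg : Measurable g) {F : Set X} (hF : F ∈ S) :
    Measurable (coronaFun S r c g F) := by
  have h1 : Measurable ((exclusive S F).indicator fun x => g x ^ r) :=
    (hg.pow_const r).indicator (hS.measurableSet_exclusive hF)
  have h2 : Measurable fun x => ∑ F' ∈ children S F, F'.indicator (fun _ => c F' ^ r) x :=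
    measurable_sum_indicator (fun P hP => hS.measurableSet P (Finset.mem_filter.1 hP).1) _
  exact (h1.add h2).pow_const _

theorem IsNested.lintegral_coronaFun (hS : IsNested S) {r : ℝ} (hr : 0 < r) (c : Set X → ℝ≥0∞)
    {g : X → ℝ≥0∞} (hg : Measurable g) (w : Measure X) {F : Set X} (hF : F ∈ S) :
    ∫⁻ x, coronaFun S r c g F x ^ r ∂w =
      ∫⁻ x in exclusive S F, g x ^ r ∂w + ∑ F' ∈ children S F, c F' ^ r * w F' := by
  have h1 : Measurable ((exclusive S F).indicator fun x => g x ^ r) :=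
    (hg.pow_const r).indicator (hS.measurableSet_exclusive hF)
  have hm : ∀ P ∈ children S F, MeasurableSet P :=
    fun P hP => hS.measurableSet P (Finset.mem_filter.1 hP).1
  simp only [coronaFun]
  simp_rw [← ENNReal.rpow_mul, one_div, inv_mul_cancel₀ hr.ne', ENNReal.rpow_one]
  rw [lintegral_add_left h1, lintegral_indicator (hS.measurableSet_exclusive hF),
    lintegral_sum_indicator hm]

/-- The exclusive parts are disjoint, so `g` is integrated at most once in total, and each average
`c F'` appears only for the unique parent of `F'`. -/
theorem IsNested.sum_lintegral_coronaFun_le (hS : IsNested S) {r : ℝ} (hr : 0 < r)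
    (c : Set X → ℝ≥0∞) {g : X → ℝ≥0∞} (hg : Measurable g) (w : Measure X) :
    ∑ F ∈ S, ∫⁻ x, coronaFun S r c g F x ^ r ∂w ≤
      ∫⁻ x, g x ^ r ∂w + ∑ F ∈ S, c F ^ r * w F := by
  rw [Finset.sum_congr rfl fun F hF => hS.lintegral_coronaFun hr c hg w hF,
    Finset.sum_add_distrib]
  refine add_le_add ?_ (sum_children_le S fun F => c F ^ r * w F)
  rw [← lintegral_biUnion_finset hS.exclusive_pairwiseDisjoint
    (fun F hF => hS.measurableSet_exclusive hF)]
  exact setLIntegral_le_lintegral _ _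

/-- Averaging `g` over a child that lies in `Q` or misses it does not change the integral over `Q`.
Thus `g` may be replaced, within one corona, by a function whose norms are summable over all
coronas. -/
theorem IsNested.setLIntegral_le_coronaFun (hS : IsNested S) {r : ℝ} (hr : 0 < r)
    {g : X → ℝ≥0∞} (hg : Measurable g) {w : Measure X} (hw : ∀ F ∈ S, w F ≠ 0)
    (hw' : ∀ F ∈ S, w F ≠ ⊤) {F : Set X} (hF : F ∈ S) {Q : Set X} (hQF : Q ⊆ F)
    (hQc : ∀ F' ∈ children S F, F' ⊆ Q ∨ Disjoint F' Q) :
    ∫⁻ x in Q, g x ∂w ≤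
      ∫⁻ x in Q, coronaFun S r (fun F => (∫⁻ x in F, g x ∂w) / w F) g F x ∂w := by
  set c : Set X → ℝ≥0∞ := fun F => (∫⁻ x in F, g x ∂w) / w F
  set gF := coronaFun S r c g F with hgF
  have hm : ∀ P ∈ children S F, MeasurableSet P :=
    fun P hP => hS.measurableSet P (Finset.mem_filter.1 hP).1
  set U := ⋃ F' ∈ children S F, F' with hU
  have hUm : MeasurableSet U := Finset.measurableSet_biUnion _ hm
  have hgFm : Measurable gF := hS.measurable_coronaFun c hg hF
  have hE : ∀ x ∈ exclusive S F, g x ≤ gF x := by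
    intro x hx
    rw [hgF, coronaFun, one_div, ENNReal.le_rpow_inv_iff hr, Set.indicator_of_mem hx]
    exact le_self_add
  have hC : ∀ F' ∈ children S F, ∀ x ∈ F', c F' ≤ gF x := by
    intro F' hF' x hx
    rw [hgF, coronaFun, one_div, ENNReal.le_rpow_inv_iff hr]
    refine le_trans ?_ le_add_self
    refine le_trans (le_of_eq ?_) (Finset.single_le_sum
      (f := fun P => (P : Set X).indicator (fun _ => c P ^ r) x) (fun _ _ => zero_le) hF')
    simp [hx]
  have hQU : Q ∩ U = ⋃ F' ∈ (children S F).filter (· ⊆ Q), id F' := by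
    ext x
    simp only [hU, Set.mem_inter_iff, Set.mem_iUnion, Finset.mem_filter, exists_prop, id]
    constructor
    · rintro ⟨hxQ, F', hF', hx⟩
      rcases hQc F' hF' with h | h
      · exact ⟨F', ⟨hF', h⟩, hx⟩
      · exact absurd hxQ (Set.disjoint_left.1 h hx)
    · rintro ⟨F', ⟨hF', h⟩, hx⟩
      exact ⟨h hx, F', hF', hx⟩
  have hdisj : (↑((children S F).filter (· ⊆ Q)) : Set (Set X)).PairwiseDisjoint id :=
    (hS.children_pairwiseDisjoint F).subset (by
      rw [Finset.coe_subset]; exact Finset.filter_subset _ _)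
  rw [← lintegral_inter_add_sdiff g Q hUm, ← lintegral_inter_add_sdiff gF Q hUm, hQU,
    lintegral_biUnion_finset hdisj (fun P hP => hm P (Finset.mem_filter.1 hP).1),
    lintegral_biUnion_finset hdisj (fun P hP => hm P (Finset.mem_filter.1 hP).1)]
  refine add_le_add (Finset.sum_le_sum fun F' hF' => ?_) ?_
  · have hF'' := (Finset.mem_filter.1 hF').1
    have hF'S := (Finset.mem_filter.1 hF'').1
    calc ∫⁻ x in id F', g x ∂w = c F' * w F' :=
          (ENNReal.div_mul_cancel (hw F' hF'S) (hw' F' hF'S)).symm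
      _ = ∫⁻ x in F', c F' ∂w := (setLIntegral_const _ _).symm
      _ ≤ ∫⁻ x in id F', gF x ∂w := setLIntegral_mono hgFm (hC F' hF'')
  · exact setLIntegral_mono hgFm fun x hx => hE x ⟨hQF hx.1, hx.2⟩

/-- The Carleson constant of `sum_rpow_mul_measure_le`. -/
def principalConst (p : ℝ) : ℝ≥0∞ := (1 - (2⁻¹ : ℝ≥0∞) ^ (p - 1))⁻¹ ^ p

/-- The constant of `bilinear_le_of_testing`. -/
def coronaConst (p q : ℝ) : ℝ≥0∞ :=
  2 * ((1 + 2 ^ p * principalConst p) ^ (1 / p - 1 / q) *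
    (principalConst p + (1 + 2 ^ p * principalConst p)))

theorem principalConst_ne_top {p : ℝ} (hp : 1 < p) : principalConst p ≠ ⊤ :=
  ENNReal.rpow_ne_top_of_nonneg (by linarith)
    (inv_one_sub_ne_top (ENNReal.rpow_lt_one ENNReal.one_half_lt_one (by linarith)))

theorem coronaConst_ne_top {p q : ℝ} (hp : 1 < p) (hpq : p ≤ q) : coronaConst p q ≠ ⊤ := by
  have h := principalConst_ne_top hp
  have h1 : 1 + 2 ^ p * principalConst p ≠ ⊤ :=
    ENNReal.add_ne_top.2 ⟨ENNReal.one_ne_top, ENNReal.mul_ne_top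
      (ENNReal.rpow_ne_top_of_nonneg (by linarith) ENNReal.ofNat_ne_top) h⟩
  have h2 : 0 ≤ 1 / p - 1 / q :=
    sub_nonneg.2 (one_div_le_one_div_of_le (by linarith) hpq)
  exact ENNReal.mul_ne_top ENNReal.ofNat_ne_top (ENNReal.mul_ne_top
    (ENNReal.rpow_ne_top_of_nonneg h2 h1) (ENNReal.add_ne_top.2 ⟨h, h1⟩))

theorem setLIntegral_ne_top_of_rpow {p p' : ℝ} (hpp : p.HolderConjugate p') {σ : Measure X}
    {f : X → ℝ≥0∞} (hf : Measurable f) (hf1 : ∫⁻ x, f x ^ p ∂σ ≠ ⊤) {Q : Set X} (hQ : σ Q ≠ ⊤) :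
    ∫⁻ x in Q, f x ∂σ ≠ ⊤ := by
  have h := ENNReal.lintegral_mul_le_Lp_mul_Lq (σ.restrict Q) hpp hf.aemeasurable
    (measurable_const (a := (1 : ℝ≥0∞))).aemeasurable
  simp only [Pi.mul_apply, mul_one, ENNReal.one_rpow, lintegral_const, one_mul,
    Measure.restrict_apply_univ] at h
  refine ne_top_of_le_ne_top (ENNReal.mul_ne_top ?_ ?_) h
  · exact ENNReal.rpow_ne_top_of_nonneg (one_div_nonneg.2 hpp.nonneg)
      (ne_top_of_le_ne_top hf1 (setLIntegral_le_lintegral _ _))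
  · exact ENNReal.rpow_ne_top_of_nonneg (one_div_nonneg.2 hpp.symm.nonneg) hQ

/-- If the averages of `g` are dominated by those of `f`, the testing condition for `σ` bounds the
bilinear form. -/
theorem bilinear_le_of_testing_of_ne_zero {p p' q q' : ℝ} (hpp : p.HolderConjugate p')
    (hqq : q.HolderConjugate q') (hpq : p ≤ q) (hS : IsNested S) (σ w : Measure X)
    {f g : X → ℝ≥0∞} (hf : Measurable f) (hg : Measurable g) (a : Set X → ℝ≥0∞) {A : ℝ≥0∞}
    (hσ : ∀ Q ∈ S, σ Q ≠ 0) (hσ' : ∀ Q ∈ S, σ Q ≠ ⊤)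
    (hw : ∀ Q ∈ S, w Q ≠ 0) (hw' : ∀ Q ∈ S, w Q ≠ ⊤)
    (hf1 : ∫⁻ x, f x ^ p ∂σ ≤ 1) (hg1 : ∫⁻ x, g x ^ q' ∂w ≤ 1)
    (htest : ∀ R ∈ S, ∫⁻ x, (∑ Q ∈ S with Q ⊆ R, Q.indicator (fun _ => a Q * σ Q) x) ^ q ∂w ≤
      A ^ q * σ R ^ (q / p))
    (hdom : ∀ Q ∈ S, ((∫⁻ x in Q, g x ∂w) / w Q) ^ q' * w Q ≤
      ((∫⁻ x in Q, f x ∂σ) / σ Q) ^ p * σ Q)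
    (hf0 : ∀ Q ∈ S, ∫⁻ x in Q, f x ∂σ ≠ 0) :
    ∑ Q ∈ S, a Q * (∫⁻ x in Q, f x ∂σ) * (∫⁻ x in Q, g x ∂w) ≤ coronaConst p q * A := by
  have hp0 := hpp.pos
  have hq0 := hqq.pos
  have hq'0 := hqq.symm.pos
  set τ : Set X → ℝ≥0∞ := fun Q => ∫⁻ x in Q, f x ∂σ with hτ
  set c : Set X → ℝ≥0∞ := fun Q => (∫⁻ x in Q, g x ∂w) / w Q with hc
  set m : Set X → ℝ≥0∞ := fun Q => τ Q / σ Q with hm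
  have hτt : ∀ Q ∈ S, τ Q ≠ ⊤ := fun Q hQ => setLIntegral_ne_top_of_rpow hpp hf
    (ne_top_of_le_ne_top ENNReal.one_ne_top hf1) (hσ' Q hQ)
  have hmσ : ∀ Q ∈ S, m Q * σ Q = τ Q := fun Q hQ => ENNReal.div_mul_cancel (hσ Q hQ) (hσ' Q hQ)
  -- The averages `m Q` must be positive and finite to have an integer dyadic level.
  obtain ⟨ℓ, hℓ, hmℓ, hℓm⟩ := exists_level S m
    (fun Q hQ => ENNReal.div_ne_zero.2 ⟨hf0 Q hQ, hσ' Q hQ⟩)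
    (fun Q hQ => ENNReal.div_ne_top (hτt Q hQ) (hσ Q hQ))
  set 𝓕 := principal S ℓ with h𝓕
  have h𝓕S : 𝓕 ⊆ S := Finset.filter_subset _ _
  have h𝓕n : IsNested 𝓕 := hS.mono h𝓕S
  have hlt : ∀ P ∈ 𝓕, ∀ Q ∈ S, P ⊂ Q → ℓ Q < ℓ P := fun P hP => (Finset.mem_filter.1 hP).2
  set b : Set X → ℝ≥0∞ := fun Q => 2 ^ ℓ Q with hb
  have hbt : ∀ Q, b Q ≠ ⊤ := fun Q => ENNReal.zpow_ne_top two_ne_zero ENNReal.ofNat_ne_top _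
  set C₁ := principalConst p with hC₁
  set Y := 1 + 2 ^ p * C₁ with hY
  -- the Carleson property of the principal family
  have hx : ∑ F ∈ 𝓕, b F ^ p * σ F ≤ C₁ := by
    refine (sum_rpow_mul_measure_le hpp h𝓕n σ hf b (fun F _ => hbt F)
      (fun F hF => hσ' F (h𝓕S hF)) ?_ ?_).trans ?_
    · intro P hP Q hQ hPQ
      have h1 : ℓ Q ≤ -1 + ℓ P := by have := hlt P hP Q (h𝓕S hQ) hPQ; omega
      calc b Q ≤ 2 ^ (-1 + ℓ P) := ENNReal.zpow_le_of_le ENNReal.one_lt_two.le h1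
        _ = 2⁻¹ * b P := by
            rw [ENNReal.zpow_add two_ne_zero ENNReal.ofNat_ne_top, zpow_neg_one]
    · intro F hF
      calc b F * σ F ≤ m F * σ F := by gcongr; exact hℓm F hF
        _ = τ F := hmσ F (h𝓕S hF)
    · calc _ ≤ C₁ * 1 := by rw [hC₁, principalConst]; gcongr
        _ = C₁ := mul_one _
  set y : Set X → ℝ≥0∞ := fun F => ∫⁻ x, coronaFun 𝓕 q' c g F x ^ q' ∂w with hydef
  -- Here domination enters: the averages of `g` over the stopping members are paid for by the
  -- Carleson sum of `f`, the factor `2 ^ p` coming from `m F ≤ 2 * b F`.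
  have hy : ∑ F ∈ 𝓕, y F ≤ Y := by
    refine (h𝓕n.sum_lintegral_coronaFun_le hq'0 c hg w).trans (add_le_add hg1 ?_)
    calc ∑ F ∈ 𝓕, c F ^ q' * w F ≤ ∑ F ∈ 𝓕, 2 ^ p * (b F ^ p * σ F) := by
          refine Finset.sum_le_sum fun F hF => (hdom F (h𝓕S hF)).trans ?_
          rw [← mul_assoc, ← ENNReal.mul_rpow_of_nonneg _ _ hp0.le]
          gcongr
          exact hmℓ F (h𝓕S hF)
      _ ≤ 2 ^ p * C₁ := by rw [← Finset.mul_sum]; gcongr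
  -- the part of the form in one corona
  have htree : ∀ F ∈ 𝓕, ∑ Q ∈ S with Q ⊆ F ∧ ℓ Q = ℓ F, a Q * τ Q * (∫⁻ x in Q, g x ∂w) ≤
      2 * A * ((b F ^ p * σ F) ^ (1 / p) * y F ^ (1 / q')) := by
    intro F hF
    have hFS := h𝓕S hF
    set gF := coronaFun 𝓕 q' c g F with hgF
    have hgFm : Measurable gF := h𝓕n.measurable_coronaFun c hg hF
    set Tσ : X → ℝ≥0∞ := fun x => ∑ Q ∈ S with Q ⊆ F, Q.indicator (fun _ => a Q * σ Q) x with hT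
    have hTm : Measurable Tσ := measurable_sum_indicator
      (fun Q hQ => hS.measurableSet Q (Finset.mem_filter.1 hQ).1) _
    have hQ1 : ∀ Q ∈ S.filter (fun Q => Q ⊆ F ∧ ℓ Q = ℓ F),
        a Q * τ Q * (∫⁻ x in Q, g x ∂w) ≤
          2 * b F * ∫⁻ x, Q.indicator (fun x => a Q * σ Q * gF x) x ∂w := by
      intro Q hQ
      obtain ⟨hQS, hQF, hQℓ⟩ := Finset.mem_filter.1 hQ
      rw [lintegral_indicator (hS.measurableSet Q hQS), lintegral_const_mul _ hgFm]
      have h1 : τ Q ≤ 2 * b F * σ Q := by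
        rw [← hmσ Q hQS]
        gcongr
        rw [hb]; simp only; rw [← hQℓ]
        exact hmℓ Q hQS
      have h2 : ∫⁻ x in Q, g x ∂w ≤ ∫⁻ x in Q, gF x ∂w := by
        refine h𝓕n.setLIntegral_le_coronaFun hq'0 hg (fun P hP => hw P (h𝓕S hP))
          (fun P hP => hw' P (h𝓕S hP)) hF hQF fun F' hF' => ?_
        obtain ⟨hF'𝓕, hF'F, -⟩ := Finset.mem_filter.1 hF'
        -- A child `F'` cannot contain `Q`: that would give `ℓ Q ≥ ℓ F' > ℓ F = ℓ Q`.
        rcases hS.nested F' (h𝓕S hF'𝓕) Q hQS with h | h | h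
        · exact Or.inl h
        · have h3 := hlt F' hF'𝓕 F hFS hF'F
          have h4 := hℓ F' (h𝓕S hF'𝓕) Q hQS h
          omega
        · exact Or.inr h
      calc a Q * τ Q * (∫⁻ x in Q, g x ∂w)
          ≤ a Q * (2 * b F * σ Q) * (∫⁻ x in Q, gF x ∂w) := by gcongr
        _ = _ := by ring
    calc ∑ Q ∈ S with Q ⊆ F ∧ ℓ Q = ℓ F, a Q * τ Q * (∫⁻ x in Q, g x ∂w)
        ≤ ∑ Q ∈ S with Q ⊆ F ∧ ℓ Q = ℓ F,
            2 * b F * ∫⁻ x, Q.indicator (fun x => a Q * σ Q * gF x) x ∂w :=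
          Finset.sum_le_sum hQ1
      _ ≤ ∑ Q ∈ S with Q ⊆ F,
            2 * b F * ∫⁻ x, Q.indicator (fun x => a Q * σ Q * gF x) x ∂w := by
          refine Finset.sum_le_sum_of_subset fun Q hQ => ?_
          rw [Finset.mem_filter] at hQ ⊢
          exact ⟨hQ.1, hQ.2.1⟩
      _ = 2 * b F * ∫⁻ x, (Tσ * gF) x ∂w := by
          rw [← Finset.mul_sum, ← lintegral_finsetSum' _ fun Q hQ =>
            ((hgFm.const_mul _).indicator
              (hS.measurableSet Q (Finset.mem_filter.1 hQ).1)).aemeasurable]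
          congr 1
          refine lintegral_congr fun x => ?_
          simp only [Pi.mul_apply, hT, Finset.sum_mul]
          refine Finset.sum_congr rfl fun Q _ => ?_
          by_cases hx : x ∈ Q <;> simp [hx]
      _ ≤ 2 * b F * ((∫⁻ x, Tσ x ^ q ∂w) ^ (1 / q) * y F ^ (1 / q')) := by
          gcongr
          exact ENNReal.lintegral_mul_le_Lp_mul_Lq w hqq hTm.aemeasurable hgFm.aemeasurable
      _ ≤ 2 * b F * ((A ^ q * σ F ^ (q / p)) ^ (1 / q) * y F ^ (1 / q')) := by
          gcongr
          exact htest F hFS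
      _ = _ := by
          rw [ENNReal.mul_rpow_of_nonneg _ _ (by positivity),
            ENNReal.mul_rpow_of_nonneg _ _ (by positivity), ← ENNReal.rpow_mul,
            ← ENNReal.rpow_mul, ← ENNReal.rpow_mul, mul_one_div_cancel hq0.ne',
            mul_one_div_cancel hp0.ne', ENNReal.rpow_one, ENNReal.rpow_one,
            show q / p * (1 / q) = 1 / p by field_simp]
          ring
  have hδ : 0 ≤ 1 / p - 1 / q := sub_nonneg.2 (one_div_le_one_div_of_le hp0 hpq)
  -- The exponents `1 / p` and `1 / q'` exceed total `1` by `1 / p - 1 / q`. The excess power of `y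
  -- F` is bounded by that of `Y`, and the remaining exponents `1 / p + 1 / p' = 1` give a linear
  -- bound that can be summed.
  have hyoung : ∀ F ∈ 𝓕, (b F ^ p * σ F) ^ (1 / p) * y F ^ (1 / q') ≤
      Y ^ (1 / p - 1 / q) * (b F ^ p * σ F + y F) := by
    intro F hF
    set u := b F ^ p * σ F
    have hp'n : 0 ≤ 1 / p' := one_div_nonneg.2 hpp.symm.nonneg
    have hpn : 0 ≤ 1 / p := one_div_nonneg.2 hpp.nonneg
    have hexp : 1 / q' = (1 / p - 1 / q) + 1 / p' := by
      have h1 := hpp.inv_add_inv_eq_one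
      have h2 := hqq.inv_add_inv_eq_one
      simp only [one_div]; linarith
    have hyY : y F ≤ Y := (Finset.single_le_sum (fun _ _ => zero_le) hF).trans hy
    rw [hexp, ENNReal.rpow_add_of_nonneg _ _ hδ hp'n]
    calc u ^ (1 / p) * (y F ^ (1 / p - 1 / q) * y F ^ (1 / p'))
        = y F ^ (1 / p - 1 / q) * (u ^ (1 / p) * y F ^ (1 / p')) := by ring
      _ ≤ Y ^ (1 / p - 1 / q) * ((u + y F) ^ (1 / p) * (u + y F) ^ (1 / p')) := by
          gcongr
          · exact le_self_add
          · exact le_add_self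
      _ = _ := by
          rw [← ENNReal.rpow_add_of_nonneg _ _ hpn hp'n, one_div p, one_div p',
            hpp.inv_add_inv_eq_one, ENNReal.rpow_one]
  calc ∑ Q ∈ S, a Q * τ Q * (∫⁻ x in Q, g x ∂w)
      ≤ ∑ Q ∈ S, ∑ F ∈ 𝓕, if Q ⊆ F ∧ ℓ Q = ℓ F then a Q * τ Q * (∫⁻ x in Q, g x ∂w) else 0 := by
        refine Finset.sum_le_sum fun Q hQ => ?_
        obtain ⟨F, hF, hQF⟩ := exists_principal hℓ hQ
        refine le_trans (le_of_eq ?_) (Finset.single_le_sum (f := fun F =>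
          if Q ⊆ F ∧ ℓ Q = ℓ F then a Q * τ Q * (∫⁻ x in Q, g x ∂w) else 0)
          (fun _ _ => zero_le) hF)
        simp only [if_pos hQF]
    _ = ∑ F ∈ 𝓕, ∑ Q ∈ S with Q ⊆ F ∧ ℓ Q = ℓ F, a Q * τ Q * (∫⁻ x in Q, g x ∂w) := by
        rw [Finset.sum_comm]
        simp only [Finset.sum_filter]
    _ ≤ ∑ F ∈ 𝓕, 2 * A * (Y ^ (1 / p - 1 / q) * (b F ^ p * σ F + y F)) := by
        refine Finset.sum_le_sum fun F hF => (htree F hF).trans ?_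
        gcongr 2 * A * ?_
        exact hyoung F hF
    _ = 2 * A * (Y ^ (1 / p - 1 / q) * (∑ F ∈ 𝓕, b F ^ p * σ F + ∑ F ∈ 𝓕, y F)) := by
        rw [← Finset.mul_sum, ← Finset.mul_sum, Finset.sum_add_distrib]
    _ ≤ 2 * A * (Y ^ (1 / p - 1 / q) * (C₁ + Y)) := by gcongr
    _ = coronaConst p q * A := by rw [coronaConst]; ring

end Corona

/-! ### The two halves of the bilinear estimate -/

section Bilinear

variable {X : Type*} [MeasurableSpace X] {S : Finset (Set X)}

/-- The testing condition for `σ` bounds the part of the bilinear form over those members of the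
family on which the averages of `f` dominate those of `g`. -/
theorem bilinear_le_of_testing {p p' q q' : ℝ} (hpp : p.HolderConjugate p')
    (hqq : q.HolderConjugate q') (hpq : p ≤ q) (hS : IsNested S) (σ w : Measure X)
    {f g : X → ℝ≥0∞} (hf : Measurable f) (hg : Measurable g) (a : Set X → ℝ≥0∞) {A : ℝ≥0∞}
    (hσ : ∀ Q ∈ S, σ Q ≠ 0) (hσ' : ∀ Q ∈ S, σ Q ≠ ⊤)
    (hw : ∀ Q ∈ S, w Q ≠ 0) (hw' : ∀ Q ∈ S, w Q ≠ ⊤)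
    (hf1 : ∫⁻ x, f x ^ p ∂σ ≤ 1) (hg1 : ∫⁻ x, g x ^ q' ∂w ≤ 1)
    (htest : ∀ R ∈ S, ∫⁻ x, (∑ Q ∈ S with Q ⊆ R, Q.indicator (fun _ => a Q * σ Q) x) ^ q ∂w ≤
      A ^ q * σ R ^ (q / p)) {S' : Finset (Set X)} (hS' : S' ⊆ S)
    (hdom : ∀ Q ∈ S', ((∫⁻ x in Q, g x ∂w) / w Q) ^ q' * w Q ≤
      ((∫⁻ x in Q, f x ∂σ) / σ Q) ^ p * σ Q) :
    ∑ Q ∈ S', a Q * (∫⁻ x in Q, f x ∂σ) * (∫⁻ x in Q, g x ∂w) ≤ coronaConst p q * A := by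
  -- Members on which `f` integrates to zero have no dyadic level, but they contribute nothing.
  -- Testing is inherited by the smaller family because its sums only decrease.
  set S₁ := S'.filter fun Q => ∫⁻ x in Q, f x ∂σ ≠ 0 with hS₁
  have h1 : S₁ ⊆ S := (Finset.filter_subset _ _).trans hS'
  have h := bilinear_le_of_testing_of_ne_zero hpp hqq hpq (hS.mono h1) σ w hf hg a
    (A := A) (fun Q hQ => hσ Q (h1 hQ)) (fun Q hQ => hσ' Q (h1 hQ)) (fun Q hQ => hw Q (h1 hQ))
    (fun Q hQ => hw' Q (h1 hQ)) hf1 hg1 (fun R hR => ?_)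
    (fun Q hQ => hdom Q (Finset.mem_filter.1 hQ).1) (fun Q hQ => (Finset.mem_filter.1 hQ).2)
  · refine le_trans (le_of_eq ?_) h
    refine (Finset.sum_subset (Finset.filter_subset _ _) fun Q hQ hQ' => ?_).symm
    have h0 : ∫⁻ x in Q, f x ∂σ = 0 := by
      by_contra h0
      exact hQ' (Finset.mem_filter.2 ⟨hQ, h0⟩)
    simp [h0]
  · refine (lintegral_mono fun x => ?_).trans (htest R (h1 hR))
    refine ENNReal.rpow_le_rpow ?_ hqq.nonneg
    exact Finset.sum_le_sum_of_subset (Finset.filter_subset_filter _ h1)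

/-- The constant of `bilinear_le`, given the Carleson constant `K` of the weights. -/
def bilinearConst (κ K : ℝ≥0∞) (p q : ℝ) : ℝ≥0∞ :=
  coronaConst p q * (chainConst κ (1 / p - 1 / q) * K ^ (1 / q))

theorem bilinearConst_ne_top {κ K : ℝ≥0∞} (hκ : κ < 1) (hK : K ≠ ⊤) {p q : ℝ} (hp : 1 < p)
    (hpq : p < q) : bilinearConst κ K p q ≠ ⊤ := by
  have hp0 : 0 < p := by linarith
  have hq0 : 0 < q := by linarith
  have h1 : 1 / p < 1 := by rw [div_lt_one hp0]; exact hp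
  have h2 : 0 < 1 / q := by positivity
  refine ENNReal.mul_ne_top (coronaConst_ne_top hp hpq.le) (ENNReal.mul_ne_top
    (chainConst_ne_top hκ (sub_pos.2 (one_div_lt_one_div_of_lt hp0 hpq)) (by linarith))
    (ENNReal.rpow_ne_top_of_nonneg h2.le hK))

/-- The half of the bilinear estimate where `f` dominates. -/
theorem bilinear_le_of_dominated {p p' q q' : ℝ} (hpp : p.HolderConjugate p')
    (hqq : q.HolderConjugate q') (hpq : p < q) {κ : ℝ≥0∞} (hκ : κ < 1) (hS : IsNested S)
    (σ w : Measure X) {f g : X → ℝ≥0∞} (hf : Measurable f) (hg : Measurable g)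
    (a B : Set X → ℝ≥0∞) {E K : ℝ≥0∞}
    (ha : ∀ Q ∈ S, a Q ≠ 0) (ha' : ∀ Q ∈ S, a Q ≠ ⊤)
    (hgeo : ∀ P ∈ S, ∀ Q ∈ S, P ⊂ Q → a Q ≤ κ * a P)
    (hσ : ∀ Q ∈ S, σ Q ≠ 0) (hσ' : ∀ Q ∈ S, σ Q ≠ ⊤)
    (hw : ∀ Q ∈ S, w Q ≠ 0) (hw' : ∀ Q ∈ S, w Q ≠ ⊤)
    (hB : ∀ Q ∈ S, B Q ≠ 0) (hB' : ∀ Q ∈ S, B Q ≠ ⊤)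
    (hE : ∀ Q ∈ S, a Q * σ Q ^ (1 / p') * w Q ^ (1 / q) * B Q ^ (1 / q) ≤ E)
    (hK : ∀ R ∈ S, ∑ Q ∈ S with Q ⊆ R, σ Q / B Q ≤ K * σ R)
    (hf1 : ∫⁻ x, f x ^ p ∂σ ≤ 1) (hg1 : ∫⁻ x, g x ^ q' ∂w ≤ 1)
    {S' : Finset (Set X)} (hS' : S' ⊆ S)
    (hdom : ∀ Q ∈ S', ((∫⁻ x in Q, g x ∂w) / w Q) ^ q' * w Q ≤
      ((∫⁻ x in Q, f x ∂σ) / σ Q) ^ p * σ Q) :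
    ∑ Q ∈ S', a Q * (∫⁻ x in Q, f x ∂σ) * (∫⁻ x in Q, g x ∂w) ≤ bilinearConst κ K p q * E := by
  have hexp : 1 / p' = 1 - 1 / p := by
    have := hpp.inv_add_inv_eq_one
    simp only [one_div]; linarith
  have h := bilinear_le_of_testing hpp hqq hpq.le hS σ w hf hg a
    (A := chainConst κ (1 / p - 1 / q) * E * K ^ (1 / q)) hσ hσ' hw hw' hf1 hg1
    (fun R hR => ?_) hS' hdom
  · refine h.trans (le_of_eq ?_)
    rw [bilinearConst]; ring
  · refine (testing (E := E) hpp.lt hpq hκ hS σ w a B ha ha' hgeo hσ hσ' hB hB' (fun Q hQ => ?_) hK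
      hR).trans (le_of_eq ?_)
    · rw [← hexp]; exact hE Q hQ
    · rw [ENNReal.mul_rpow_of_nonneg _ (K ^ (1 / q)) hqq.nonneg, ← ENNReal.rpow_mul,
        one_div_mul_cancel hqq.pos.ne', ENNReal.rpow_one]

/-- The bilinear estimate for normalized functions. -/
theorem bilinear_le {p p' q q' : ℝ} (hpp : p.HolderConjugate p')
    (hqq : q.HolderConjugate q') (hpq : p < q) {κ : ℝ≥0∞} (hκ : κ < 1) (hS : IsNested S)
    (σ w : Measure X) {f g : X → ℝ≥0∞} (hf : Measurable f) (hg : Measurable g)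
    (a B D : Set X → ℝ≥0∞) {E E' K : ℝ≥0∞}
    (ha : ∀ Q ∈ S, a Q ≠ 0) (ha' : ∀ Q ∈ S, a Q ≠ ⊤)
    (hgeo : ∀ P ∈ S, ∀ Q ∈ S, P ⊂ Q → a Q ≤ κ * a P)
    (hσ : ∀ Q ∈ S, σ Q ≠ 0) (hσ' : ∀ Q ∈ S, σ Q ≠ ⊤)
    (hw : ∀ Q ∈ S, w Q ≠ 0) (hw' : ∀ Q ∈ S, w Q ≠ ⊤)
    (hB : ∀ Q ∈ S, B Q ≠ 0) (hB' : ∀ Q ∈ S, B Q ≠ ⊤)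
    (hD : ∀ Q ∈ S, D Q ≠ 0) (hD' : ∀ Q ∈ S, D Q ≠ ⊤)
    (hE : ∀ Q ∈ S, a Q * σ Q ^ (1 / p') * w Q ^ (1 / q) * B Q ^ (1 / q) ≤ E)
    (hE' : ∀ Q ∈ S, a Q * σ Q ^ (1 / p') * w Q ^ (1 / q) * D Q ^ (1 / p') ≤ E')
    (hK : ∀ R ∈ S, ∑ Q ∈ S with Q ⊆ R, σ Q / B Q ≤ K * σ R)
    (hK' : ∀ R ∈ S, ∑ Q ∈ S with Q ⊆ R, w Q / D Q ≤ K * w R)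
    (hf1 : ∫⁻ x, f x ^ p ∂σ ≤ 1) (hg1 : ∫⁻ x, g x ^ q' ∂w ≤ 1) :
    ∑ Q ∈ S, a Q * (∫⁻ x in Q, f x ∂σ) * (∫⁻ x in Q, g x ∂w) ≤
      bilinearConst κ K p q * E + bilinearConst κ K q' p' * E' := by
  have hpq' : q' < p' := by
    have h1 := hpp.inv_add_inv_eq_one
    have h2 := hqq.inv_add_inv_eq_one
    have h3 : q⁻¹ < p⁻¹ := (inv_lt_inv₀ hqq.pos hpp.pos).2 hpq
    exact (inv_lt_inv₀ hpp.symm.pos hqq.symm.pos).1 (by linarith)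
  -- On the complementary part `g` dominates, and the same estimate applies with `(p, σ, f, B)` and
  -- `(q', w, g, D)` exchanged, since `q' < p'`.
  rw [← Finset.sum_filter_add_sum_filter_not S (fun Q =>
    ((∫⁻ x in Q, g x ∂w) / w Q) ^ q' * w Q ≤ ((∫⁻ x in Q, f x ∂σ) / σ Q) ^ p * σ Q)]
  refine add_le_add ?_ ?_
  · exact bilinear_le_of_dominated hpp hqq hpq hκ hS σ w hf hg a B ha ha' hgeo hσ hσ' hw hw'
      hB hB' hE hK hf1 hg1 (Finset.filter_subset _ _) fun Q hQ => (Finset.mem_filter.1 hQ).2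
  · rw [Finset.sum_congr rfl fun Q _ => mul_right_comm (a Q) _ _]
    refine bilinear_le_of_dominated hqq.symm hpp.symm hpq' hκ hS w σ hg hf a D ha ha' hgeo
      hw hw' hσ hσ' hD hD' (fun Q hQ => ?_) hK' hg1 hf1 (Finset.filter_subset _ _)
      fun Q hQ => (not_le.1 (Finset.mem_filter.1 hQ).2).le
    rw [mul_right_comm (a Q)]
    exact hE' Q hQ

end Bilinear

/-! ### Carleson sequences from sparseness and the local characteristic -/

section Carleson

variable {X : Type*} [MeasurableSpace X] {S : Finset (Set X)}

/-- In a sparse family the exclusive parts are large. -/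
theorem measure_le_exclusive {μ : Measure X} {lam : ℝ≥0∞} (hlam : lam < 1)
    (hsp : ∀ Q ∈ S, μ (⋃ P ∈ S.filter (· ⊂ Q), P) ≤ lam * μ Q) (hμ' : ∀ Q ∈ S, μ Q ≠ ⊤)
    {Q : Set X} (hQ : Q ∈ S) : μ Q ≤ (1 - lam)⁻¹ * μ (exclusive S Q) := by
  set U := ⋃ P ∈ children S Q, P with hU
  have hUm : μ U ≤ lam * μ Q := by
    refine (measure_mono ?_).trans (hsp Q hQ)
    refine Set.biUnion_subset_biUnion_left fun P hP => ?_
    have := Finset.mem_filter.1 hP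
    exact Finset.mem_filter.2 ⟨this.1, this.2.1⟩
  have h1 : μ Q ≤ lam * μ Q + μ (exclusive S Q) := by
    calc μ Q ≤ μ (U ∪ exclusive S Q) := measure_mono fun x hx => by
            by_cases h : x ∈ U
            · exact Or.inl h
            · exact Or.inr ⟨hx, h⟩
      _ ≤ μ U + μ (exclusive S Q) := measure_union_le _ _
      _ ≤ _ := by gcongr
  have hlt : lam ≠ ⊤ := (hlam.trans ENNReal.one_lt_top).ne
  have h2 : (1 - lam) * μ Q ≤ μ (exclusive S Q) := by
    rw [ENNReal.sub_mul (fun _ _ => hμ' Q hQ), one_mul]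
    exact tsub_le_iff_left.2 h1
  calc μ Q = (1 - lam)⁻¹ * ((1 - lam) * μ Q) := by
        rw [← mul_assoc, ENNReal.inv_mul_cancel (tsub_pos_of_lt hlam).ne'
          (lt_of_le_of_lt tsub_le_self ENNReal.one_lt_top).ne, one_mul]
    _ ≤ _ := by gcongr

/-- A layer of the family on which `ρ` is bounded by `t` is `σ`-Carleson with constant
proportional to `t`. -/
theorem sum_measure_le_of_layer (hS : IsNested S) {μ σ : Measure X} {lam : ℝ≥0∞} (hlam : lam < 1)
    (hsp : ∀ Q ∈ S, μ (⋃ P ∈ S.filter (· ⊂ Q), P) ≤ lam * μ Q)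
    (hμ : ∀ Q ∈ S, μ Q ≠ 0) (hμ' : ∀ Q ∈ S, μ Q ≠ ⊤)
    (ρ : Set X → ℝ≥0∞) (M : Set X → X → ℝ≥0∞)
    (hM : ∀ R ∈ S, ∀ Q ∈ S, Q ⊆ R → ∀ x ∈ Q, σ Q / μ Q ≤ M R x)
    (hρ : ∀ R ∈ S, ∫⁻ x in R, M R x ∂μ ≤ ρ R * σ R)
    {S' : Finset (Set X)} (hS' : S' ⊆ S) {t : ℝ≥0∞} (ht : ∀ Q ∈ S', ρ Q ≤ t) (R : Set X) :
    ∑ Q ∈ S' with Q ⊆ R, σ Q ≤ (1 - lam)⁻¹ * t * σ R := by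
  -- For `R` in the layer, `σ Q` is at most `(1 - lam)⁻¹` times the integral of `M R` over the
  -- exclusive part of `Q`. These parts are disjoint, so the sum is controlled by `∫_R M R ≤ ρ R * σ
  -- R ≤ t * σ R`.
  have hone : ∀ R ∈ S', ∑ Q ∈ S' with Q ⊆ R, σ Q ≤ (1 - lam)⁻¹ * t * σ R := by
    intro R hR
    have hsub : S'.filter (· ⊆ R) ⊆ S := (Finset.filter_subset _ _).trans hS'
    have hterm : ∀ Q ∈ S'.filter (· ⊆ R),
        σ Q ≤ (1 - lam)⁻¹ * ∫⁻ x in exclusive S Q, M R x ∂μ := by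
      intro Q hQ
      have hQS := hsub hQ
      calc σ Q = σ Q / μ Q * μ Q := (ENNReal.div_mul_cancel (hμ Q hQS) (hμ' Q hQS)).symm
        _ ≤ σ Q / μ Q * ((1 - lam)⁻¹ * μ (exclusive S Q)) := by
            gcongr
            exact measure_le_exclusive hlam hsp hμ' hQS
        _ = (1 - lam)⁻¹ * ∫⁻ _ in exclusive S Q, σ Q / μ Q ∂μ := by
            rw [setLIntegral_const]; ring
        _ ≤ _ := by
            gcongr (1 - lam)⁻¹ * ?_
            exact setLIntegral_mono' (hS.measurableSet_exclusive hQS) fun x hx =>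
              hM R (hS' hR) Q hQS (Finset.mem_filter.1 hQ).2 x hx.1
    calc ∑ Q ∈ S' with Q ⊆ R, σ Q
        ≤ ∑ Q ∈ S' with Q ⊆ R, (1 - lam)⁻¹ * ∫⁻ x in exclusive S Q, M R x ∂μ :=
          Finset.sum_le_sum hterm
      _ = (1 - lam)⁻¹ * ∫⁻ x in ⋃ Q ∈ S'.filter (· ⊆ R), exclusive S Q, M R x ∂μ := by
          rw [← Finset.mul_sum, lintegral_biUnion_finset
            (hS.exclusive_pairwiseDisjoint.subset (Finset.coe_subset.2 hsub))
            (fun Q hQ => hS.measurableSet_exclusive (hsub hQ))]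
      _ ≤ (1 - lam)⁻¹ * ∫⁻ x in R, M R x ∂μ := by
          gcongr (1 - lam)⁻¹ * ?_
          refine lintegral_mono_set (Set.iUnion₂_subset fun Q hQ => ?_)
          exact fun x hx => (Finset.mem_filter.1 hQ).2 hx.1
      _ ≤ (1 - lam)⁻¹ * (t * σ R) := by
          gcongr (1 - lam)⁻¹ * ?_
          exact (hρ R (hS' hR)).trans (by gcongr; exact ht R hR)
      _ = _ := by ring
  -- A general `R` need not satisfy `ρ R ≤ t`; the bound is applied to the maximal layer members
  -- inside `R`, which are disjoint.
  set T := S'.filter (· ⊆ R) with hT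
  have hTS : T ⊆ S := (Finset.filter_subset _ _).trans hS'
  set 𝓜 := T.filter fun P => ∀ P' ∈ T, P ⊆ P' → P' ⊆ P with h𝓜
  have h𝓜T : 𝓜 ⊆ T := Finset.filter_subset _ _
  have hdisj : (↑𝓜 : Set (Set X)).PairwiseDisjoint id := by
    intro P hP Q hQ hne
    have hP' := Finset.mem_filter.1 (Finset.mem_coe.1 hP)
    have hQ' := Finset.mem_filter.1 (Finset.mem_coe.1 hQ)
    rw [Function.onFun, id, id, Set.disjoint_left]
    intro x hxP hxQ
    rcases hS.ssubset_or_ssubset (hTS hP'.1) (hTS hQ'.1) hne hxP hxQ with h | h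
    · exact h.2 (hP'.2 Q hQ'.1 h.1)
    · exact h.2 (hQ'.2 P hP'.1 h.1)
  calc ∑ Q ∈ T, σ Q ≤ ∑ Q ∈ T, ∑ P ∈ 𝓜, if Q ⊆ P then σ Q else 0 := by
        refine Finset.sum_le_sum fun Q hQ => ?_
        obtain ⟨P, hQP, hP⟩ := Finset.exists_le_maximal T hQ
        have hP𝓜 : P ∈ 𝓜 := Finset.mem_filter.2 ⟨hP.1, fun P' hP' h => hP.2 hP' h⟩
        refine le_trans (le_of_eq ?_) (Finset.single_le_sum
          (f := fun P => if Q ⊆ P then σ Q else 0) (fun _ _ => zero_le) hP𝓜)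
        simp only [if_pos (show Q ⊆ P from hQP)]
    _ = ∑ P ∈ 𝓜, ∑ Q ∈ T with Q ⊆ P, σ Q := by
        rw [Finset.sum_comm]
        simp only [Finset.sum_filter]
    _ ≤ ∑ P ∈ 𝓜, (1 - lam)⁻¹ * t * σ P := by
        refine Finset.sum_le_sum fun P hP => ?_
        refine (Finset.sum_le_sum_of_subset ?_).trans
          (hone P (Finset.filter_subset _ _ (h𝓜T hP)))
        exact Finset.filter_subset_filter _ (Finset.filter_subset _ _)
    _ = (1 - lam)⁻¹ * t * σ (⋃ P ∈ 𝓜, id P) := by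
        rw [← Finset.mul_sum, measure_biUnion_finset hdisj
          fun P hP => hS.measurableSet P (hTS (h𝓜T hP))]
        rfl
    _ ≤ _ := by
        gcongr
        exact Set.iUnion₂_subset fun P hP => (Finset.mem_filter.1 (h𝓜T hP)).2

/-- Dividing by the bump makes the `σ`-measures of a sparse family a Carleson sequence. -/
theorem sum_measure_div_le (hS : IsNested S) {μ σ : Measure X} {lam : ℝ≥0∞} (hlam : lam < 1)
    (hsp : ∀ Q ∈ S, μ (⋃ P ∈ S.filter (· ⊂ Q), P) ≤ lam * μ Q)
    (hμ : ∀ Q ∈ S, μ Q ≠ 0) (hμ' : ∀ Q ∈ S, μ Q ≠ ⊤)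
    (ρ : Set X → ℝ≥0∞) (M : Set X → X → ℝ≥0∞)
    (hM : ∀ R ∈ S, ∀ Q ∈ S, Q ⊆ R → ∀ x ∈ Q, σ Q / μ Q ≤ M R x)
    (hρ : ∀ R ∈ S, ∫⁻ x in R, M R x ∂μ ≤ ρ R * σ R)
    (B : Set X → ℝ≥0∞) (e : ℕ → ℝ≥0∞)
    (hB : ∀ Q ∈ S, ∃ r : ℕ, ρ Q ≤ 2 ^ (r + 1) ∧ 2 ^ r * e r ≤ B Q) (R : Set X) :
    ∑ Q ∈ S with Q ⊆ R, σ Q / B Q ≤ 2 * (1 - lam)⁻¹ * (∑' r, (e r)⁻¹) * σ R := by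
  have hB2 : ∀ Q, ∃ r : ℕ, Q ∈ S → ρ Q ≤ 2 ^ (r + 1) ∧ 2 ^ r * e r ≤ B Q := by
    intro Q
    by_cases hQ : Q ∈ S
    · obtain ⟨r, hr⟩ := hB Q hQ
      exact ⟨r, fun _ => hr⟩
    · exact ⟨0, fun h => absurd h hQ⟩
  choose r hr using hB2
  set T := S.filter (· ⊆ R) with hT
  have hTS : T ⊆ S := Finset.filter_subset _ _
  have hinv : ∀ n : ℕ, ((2 : ℝ≥0∞) ^ n * e n)⁻¹ = (2 ^ n)⁻¹ * (e n)⁻¹ := fun n =>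
    ENNReal.mul_inv (Or.inl (pow_ne_zero _ two_ne_zero))
      (Or.inl (ENNReal.pow_ne_top ENNReal.ofNat_ne_top))
  -- On the layer with index `n` the Carleson constant is proportional to `2 ^ (n + 1)` while `B` is
  -- at least `2 ^ n * e n`; the powers of two cancel up to the factor `2`, and `(e n)⁻¹` remains to
  -- be summed.
  calc ∑ Q ∈ T, σ Q / B Q ≤ ∑ Q ∈ T, σ Q * ((2 ^ r Q)⁻¹ * (e (r Q))⁻¹) := by
        refine Finset.sum_le_sum fun Q hQ => ?_
        rw [div_eq_mul_inv, ← hinv]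
        gcongr
        exact (hr Q (hTS hQ)).2
    _ = ∑ n ∈ T.image r, ∑ Q ∈ T with r Q = n, σ Q * ((2 ^ r Q)⁻¹ * (e (r Q))⁻¹) :=
        (Finset.sum_fiberwise_of_maps_to (fun Q hQ => Finset.mem_image_of_mem r hQ) _).symm
    _ = ∑ n ∈ T.image r, (2 ^ n)⁻¹ * (e n)⁻¹ * ∑ Q ∈ T with r Q = n, σ Q := by
        refine Finset.sum_congr rfl fun n _ => ?_
        rw [Finset.mul_sum]
        refine Finset.sum_congr rfl fun Q hQ => ?_
        rw [(Finset.mem_filter.1 hQ).2, mul_comm]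
    _ ≤ ∑ n ∈ T.image r, (2 ^ n)⁻¹ * (e n)⁻¹ * ((1 - lam)⁻¹ * 2 ^ (n + 1) * σ R) := by
        gcongr with n hn
        have h := sum_measure_le_of_layer hS hlam hsp hμ hμ' ρ M hM hρ
          (S' := S.filter fun Q => r Q = n) (Finset.filter_subset _ _) (t := 2 ^ (n + 1))
          (fun Q hQ => by
            have hQ' := Finset.mem_filter.1 hQ
            rw [← hQ'.2]; exact (hr Q hQ'.1).1) R
        rwa [Finset.filter_comm] at h
    _ = ∑ n ∈ T.image r, 2 * (1 - lam)⁻¹ * σ R * (e n)⁻¹ := by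
        refine Finset.sum_congr rfl fun n _ => ?_
        calc (2 ^ n)⁻¹ * (e n)⁻¹ * ((1 - lam)⁻¹ * 2 ^ (n + 1) * σ R)
            = 2 * (1 - lam)⁻¹ * σ R * (e n)⁻¹ * (2 ^ n * (2 ^ n)⁻¹) := by ring
          _ = _ := by
            rw [ENNReal.mul_inv_cancel (pow_ne_zero _ two_ne_zero)
              (ENNReal.pow_ne_top ENNReal.ofNat_ne_top), mul_one]
    _ = 2 * (1 - lam)⁻¹ * σ R * ∑ n ∈ T.image r, (e n)⁻¹ := by rw [Finset.mul_sum]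
    _ ≤ 2 * (1 - lam)⁻¹ * σ R * ∑' n, (e n)⁻¹ := by
        gcongr
        exact ENNReal.sum_le_tsum _
    _ = _ := by ring

end Carleson

/-! ### Geometry of cubes and sparse families -/

section Cubes

variable {d : ℕ}

theorem Cube.measurableSet (Q : Cube d) : MeasurableSet Q.toSet :=
  MeasurableSet.univ_pi fun _ => measurableSet_Ico

theorem Cube.corner_mem (Q : Cube d) : Q.corner ∈ Q.toSet := fun i _ => by
  simp [Q.side_pos]

theorem Cube.volume_toSet (Q : Cube d) : volume Q.toSet = ENNReal.ofReal Q.side ^ d := by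
  rw [Cube.toSet, Real.volume_pi_Ico]
  simp

theorem Cube.volume_ne_zero (Q : Cube d) : volume Q.toSet ≠ 0 := by
  rw [Q.volume_toSet]
  exact pow_ne_zero _ (ENNReal.ofReal_pos.2 Q.side_pos).ne'

theorem Cube.volume_ne_top (Q : Cube d) : volume Q.toSet ≠ ⊤ := by
  rw [Q.volume_toSet]
  exact ENNReal.pow_ne_top ENNReal.ofReal_ne_top

/-- A half-open cube has its corner as least point, and its side is read off its volume. In
dimension `0` the side would be lost, hence `0 < d`. -/
theorem Cube.toSet_injective (hd : 0 < d) : Function.Injective (Cube.toSet (d := d)) := by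
  intro P Q h
  have hc : P.corner = Q.corner := by
    funext i
    have h1 : P.corner ∈ Q.toSet := h ▸ P.corner_mem
    have h2 : Q.corner ∈ P.toSet := h ▸ Q.corner_mem
    exact le_antisymm (h2 i (Set.mem_univ i)).1 (h1 i (Set.mem_univ i)).1
  have hv := congrArg (fun s => volume s) h
  simp only [Cube.volume_toSet] at hv
  have hs : P.side = Q.side := by
    have := (ENNReal.pow_right_strictMono hd.ne').injective hv
    rwa [ENNReal.ofReal_eq_ofReal_iff P.side_pos.le Q.side_pos.le] at this
  cases P; cases Q; simp_all

theorem Cube.exists_mem_of_dense {D : Set (Fin d → ℝ)} (hD : Dense D) (Q : Cube d) :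
    ∃ x ∈ D, x ∈ Q.toSet := by
  set U : Set (Fin d → ℝ) := Set.univ.pi fun i => Set.Ioo (Q.corner i) (Q.corner i + Q.side)
  have hU : IsOpen U := isOpen_set_pi Set.finite_univ fun _ _ => isOpen_Ioo
  have hne : U.Nonempty := by
    refine ⟨fun i => Q.corner i + Q.side / 2, fun i _ => ?_⟩
    have := Q.side_pos
    constructor <;> linarith
  obtain ⟨x, hx, hxU⟩ := hD.exists_mem_open hU hne
  exact ⟨x, hx, fun i hi => ⟨(hxU i hi).1.le, (hxU i hi).2⟩⟩

theorem IsSparse.volume_le {lam : ℝ} {S : Set (Cube d)} (hS : IsSparse lam S) {P Q : Cube d}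
    (hP : P ∈ S) (hQ : Q ∈ S) (hPQ : P.toSet ⊂ Q.toSet) :
    volume P.toSet ≤ ENNReal.ofReal lam * volume Q.toSet := by
  obtain ⟨R, hR, hPR⟩ := hS.exists_maximal Q hQ P hP hPQ
  calc volume P.toSet ≤ volume R.toSet := measure_mono hPR
    _ ≤ ∑' R : maximalSubcubes S Q, (R : Cube d).vol :=
        ENNReal.le_tsum (f := fun R : maximalSubcubes S Q => (R : Cube d).vol) ⟨R, hR⟩
    _ ≤ _ := hS.sum_le Q hQ

/-- Every cube meets a countable dense set. The cubes of the family through one point form a chain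
whose volumes drop by the factor `lam` at each proper inclusion, so at most one of them has its
volume in a given interval between consecutive powers of `lam⁻¹`. Countability is needed for
subadditivity and for monotone convergence. -/
theorem IsSparse.countable (hd : 0 < d) {lam : ℝ} {S : Set (Cube d)} (hS : IsSparse lam S) :
    S.Countable := by
  obtain ⟨D, hDc, hD⟩ := TopologicalSpace.exists_countable_dense (Fin d → ℝ)
  have hlam0 : ENNReal.ofReal lam ≠ 0 := (ENNReal.ofReal_pos.2 hS.pos).ne'
  have hlam1 : ENNReal.ofReal lam < 1 := by
    rw [ENNReal.ofReal_lt_one]; exact hS.lt_one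
  have hlvl : ∀ Q : Cube d, ∃ n : ℤ, volume Q.toSet ∈
      Set.Ico ((ENNReal.ofReal lam)⁻¹ ^ n) ((ENNReal.ofReal lam)⁻¹ ^ (n + 1)) := fun Q =>
    ENNReal.exists_mem_Ico_zpow Q.volume_ne_zero Q.volume_ne_top (ENNReal.one_lt_inv.2 hlam1)
      (ENNReal.inv_ne_top.2 hlam0)
  choose n hn using hlvl
  have hlt : ∀ P ∈ S, ∀ Q ∈ S, P.toSet ⊂ Q.toSet → n P ≠ n Q := by
    intro P hP Q hQ hPQ hne
    have h1 : volume P.toSet < (ENNReal.ofReal lam)⁻¹ ^ n Q := by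
      calc volume P.toSet ≤ ENNReal.ofReal lam * volume Q.toSet := hS.volume_le hP hQ hPQ
        _ < ENNReal.ofReal lam * (ENNReal.ofReal lam)⁻¹ ^ (n Q + 1) :=
            ENNReal.mul_lt_mul_right hlam0 ENNReal.ofReal_ne_top (hn Q).2
        _ = (ENNReal.ofReal lam)⁻¹ ^ n Q := by
            rw [ENNReal.zpow_add (ENNReal.inv_ne_zero.2 ENNReal.ofReal_ne_top)
              (ENNReal.inv_ne_top.2 hlam0), zpow_one, mul_left_comm,
              ENNReal.mul_inv_cancel hlam0 ENNReal.ofReal_ne_top, mul_one]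
    rw [← hne] at h1
    exact absurd (hn P).1 (not_le.2 h1)
  refine (Set.Countable.biUnion hDc (t := fun x _ => {Q ∈ S | x ∈ Q.toSet}) fun x _ => ?_).mono
    fun Q hQ => ?_
  · refine Set.MapsTo.countable_of_injOn (f := n) (Set.mapsTo_univ _ _) ?_
      (Set.countable_univ (α := ℤ))
    intro P hP Q hQ hne
    by_contra hPQ
    have hPQ' : P.toSet ≠ Q.toSet := fun h => hPQ (Cube.toSet_injective hd h)
    rcases hS.nested P hP.1 Q hQ.1 with h | h | h
    · exact hlt P hP.1 Q hQ.1 (h.ssubset_of_ne hPQ') hne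
    · exact hlt Q hQ.1 P hP.1 (h.ssubset_of_ne hPQ'.symm) hne.symm
    · exact Set.disjoint_left.1 h hP.2 hQ.2
  · obtain ⟨x, hx, hxQ⟩ := Q.exists_mem_of_dense hD
    exact Set.mem_biUnion hx ⟨hQ, hxQ⟩

theorem IsSparse.isNested {lam : ℝ} {S : Set (Cube d)} (hS : IsSparse lam S)
    {F : Finset (Cube d)} (hF : ↑F ⊆ S) : IsNested (F.image Cube.toSet) := by
  constructor
  · simp only [Finset.mem_image]
    rintro _ ⟨Q, -, rfl⟩
    exact Q.measurableSet
  · simp only [Finset.mem_image]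
    rintro _ ⟨Q, hQ, rfl⟩ _ ⟨P, hP, rfl⟩
    exact hS.nested Q (hF hQ) P (hF hP)

/-- A maximal subcube within a subfamily need not be maximal in the whole family, but it lies in one
that is. Stated for unions, sparseness therefore passes to finite subfamilies. -/
theorem IsSparse.volume_biUnion_le (hd : 0 < d) {lam : ℝ} {S : Set (Cube d)}
    (hS : IsSparse lam S) {F : Finset (Cube d)} (hF : ↑F ⊆ S) :
    ∀ Q ∈ F.image Cube.toSet,
      volume (⋃ P ∈ (F.image Cube.toSet).filter (· ⊂ Q), P) ≤ ENNReal.ofReal lam * volume Q := by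
  simp only [Finset.mem_image]
  rintro _ ⟨Q, hQ, rfl⟩
  have hc : Countable (maximalSubcubes S Q) :=
    ((hS.countable hd).mono fun R hR => hR.1).to_subtype
  calc volume (⋃ P ∈ (F.image Cube.toSet).filter (· ⊂ Q.toSet), P)
      ≤ volume (⋃ R : maximalSubcubes S Q, (R : Cube d).toSet) := by
        refine measure_mono (Set.iUnion₂_subset fun P hP => ?_)
        obtain ⟨hP, hPQ⟩ := Finset.mem_filter.1 hP
        obtain ⟨P', hP', rfl⟩ := Finset.mem_image.1 hP
        obtain ⟨R, hR, hPR⟩ := hS.exists_maximal Q (hF hQ) P' (hF hP') hPQ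
        exact hPR.trans (Set.subset_iUnion (fun R : maximalSubcubes S Q => (R : Cube d).toSet)
          ⟨R, hR⟩)
    _ ≤ ∑' R : maximalSubcubes S Q, volume (R : Cube d).toSet := measure_iUnion_le _
    _ ≤ _ := hS.sum_le Q (hF hQ)

end Cubes

/-! ### Weights and their local characteristic -/

section Weights

variable {d : ℕ} {σ : (Fin d → ℝ) → ℝ}

theorem IsWeight.aemeasurable (hσ : IsWeight σ) :
    AEMeasurable (fun x => ENNReal.ofReal (σ x)) volume :=
  hσ.locallyIntegrable.aestronglyMeasurable.aemeasurable.ennreal_ofReal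

theorem IsWeight.ofReal_eq_enorm (hσ : IsWeight σ) (x : Fin d → ℝ) :
    ENNReal.ofReal (σ x) = ‖σ x‖ₑ := (Real.enorm_of_nonneg (hσ.nonneg x)).symm

theorem IsWeight.weightMeasure_ne_top (hσ : IsWeight σ) (Q : Cube d) :
    weightMeasure σ Q.toSet ≠ ⊤ := by
  rw [weightMeasure, withDensity_apply _ Q.measurableSet]
  have hK : IsCompact (Set.univ.pi fun i => Set.Icc (Q.corner i) (Q.corner i + Q.side)) :=
    isCompact_univ_pi fun _ => isCompact_Icc
  have h := (hσ.locallyIntegrable.integrableOn_isCompact hK).2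
  rw [hasFiniteIntegral_iff_enorm] at h
  refine ((lintegral_mono_set (Set.pi_mono fun i _ => Set.Ico_subset_Icc_self)).trans_lt ?_).ne
  simpa only [hσ.ofReal_eq_enorm] using h

theorem IsWeight.avg_indicator (hσ : IsWeight σ) {P Q : Cube d} (h : P.toSet ⊆ Q.toSet) :
    avg (Q.toSet.indicator σ) P = weightMeasure σ P.toSet / volume P.toSet := by
  rw [avg, Cube.vol, weightMeasure, withDensity_apply _ P.measurableSet]
  congr 1
  refine setLIntegral_congr_fun P.measurableSet fun x hx => ?_
  simp only [Set.indicator_of_mem (h hx), hσ.ofReal_eq_enorm]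

/-- On `Q`, the maximal function of `σ 1_Q` is at least the average of `σ` over `Q` itself. -/
theorem IsWeight.one_le_localChar (hσ : IsWeight σ) {Q : Cube d}
    (h0 : weightMeasure σ Q.toSet ≠ 0) : 1 ≤ localChar Q σ := by
  rw [localChar, ENNReal.le_div_iff_mul_le (Or.inl h0) (Or.inl (hσ.weightMeasure_ne_top Q)),
    one_mul]
  calc weightMeasure σ Q.toSet
      = weightMeasure σ Q.toSet / volume Q.toSet * volume Q.toSet :=
        (ENNReal.div_mul_cancel Q.volume_ne_zero Q.volume_ne_top).symm
    _ = ∫⁻ _ in Q.toSet, weightMeasure σ Q.toSet / volume Q.toSet := by rw [setLIntegral_const]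
    _ ≤ _ := by
        refine setLIntegral_mono' Q.measurableSet fun x hx => ?_
        rw [← hσ.avg_indicator subset_rfl]
        exact le_iSup₂ (f := fun (P : Cube d) (_ : x ∈ P.toSet) =>
          avg (Q.toSet.indicator σ) P) Q hx

/-- The function `f` is controlled only almost everywhere for `σ dx`, so it is arbitrary where `σ`
vanishes; the factor `σ` makes this harmless and allows a Borel representative `φ` of `|f|`. -/
theorem setLIntegral_enorm_mul (hσ : IsWeight σ) {f : (Fin d → ℝ) → ℝ} {φ : (Fin d → ℝ) → ℝ≥0∞}
    (hφ : Measurable φ) (hfφ : (fun x => ‖f x‖ₑ) =ᵐ[weightMeasure σ] φ) (Q : Cube d) :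
    ∫⁻ x in Q.toSet, ‖σ x * f x‖ₑ = ∫⁻ x in Q.toSet, φ x ∂weightMeasure σ := by
  have hf : AEMeasurable (fun x => ‖f x‖ₑ) (weightMeasure σ) := ⟨φ, hφ, hfφ⟩
  rw [← lintegral_congr_ae (ae_restrict_of_ae hfφ), weightMeasure,
    restrict_withDensity Q.measurableSet,
    lintegral_withDensity_eq_lintegral_mul₀' hσ.aemeasurable.restrict]
  · refine lintegral_congr fun x => ?_
    rw [Pi.mul_apply, enorm_mul, hσ.ofReal_eq_enorm]
  · rw [← restrict_withDensity Q.measurableSet]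
    exact hf.restrict

end Weights

/-! ### Dyadic scales of the bump, and duality -/

/-- A finite bump is nonzero and is bounded below on the dyadic scale of `ρ`. -/
theorem bump_spec {ε : ℝ → ℝ} (hε_pos : ∀ t, 1 ≤ t → 0 < ε t) (hε_mono : MonotoneOn ε (Set.Ici 1))
    {ρ : ℝ≥0∞} (hρ : 1 ≤ ρ) (hb : bump ε ρ ≠ ⊤) :
    bump ε ρ ≠ 0 ∧ ∃ r : ℕ, ρ ≤ 2 ^ (r + 1) ∧
      2 ^ r * ENNReal.ofReal (ε (2 ^ r)) ≤ bump ε ρ := by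
  have hρt : ρ ≠ ⊤ := fun h => hb (by rw [bump, if_pos h])
  rw [bump, if_neg hρt]
  have h1 : 1 ≤ ρ.toReal := by
    rw [← ENNReal.toReal_one]
    exact ENNReal.toReal_mono hρt hρ
  refine ⟨mul_ne_zero (one_pos.trans_le hρ).ne' (ENNReal.ofReal_pos.2 (hε_pos _ h1)).ne', ?_⟩
  obtain ⟨r, hr1, hr2⟩ := exists_nat_pow_near h1 (one_lt_two (α := ℝ))
  have e : ∀ n : ℕ, (2 : ℝ≥0∞) ^ n = ENNReal.ofReal ((2 : ℝ) ^ n) := fun n => by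
    rw [ENNReal.ofReal_pow (by norm_num)]; simp
  have hr1' : (2 : ℝ≥0∞) ^ r ≤ ρ := by
    rw [e]; exact ENNReal.ofReal_le_of_le_toReal hr1
  refine ⟨r, ?_, ?_⟩
  · rw [e, ENNReal.le_ofReal_iff_toReal_le hρt (by positivity)]
    exact hr2.le
  · gcongr
    exact hε_mono (Set.mem_Ici.2 (one_le_pow₀ one_le_two)) h1 hr1

/-- The `L^q` norm is bounded by the pairings with normalized functions. -/
theorem rpow_lintegral_le_of_pairing {X : Type*} [MeasurableSpace X] {q q' : ℝ}
    (hqq : q.HolderConjugate q') {w : Measure X} {h : X → ℝ≥0∞} (hh : Measurable h)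
    (hfin : ∫⁻ x, h x ^ q ∂w ≠ ⊤) {C : ℝ≥0∞}
    (hC : ∀ g : X → ℝ≥0∞, Measurable g → ∫⁻ x, g x ^ q' ∂w ≤ 1 → ∫⁻ x, h x * g x ∂w ≤ C) :
    ∫⁻ x, h x ^ q ∂w ≤ C ^ q := by
  set N := ∫⁻ x, h x ^ q ∂w with hN
  rcases eq_or_ne N 0 with h0 | h0
  · rw [h0]; exact zero_le
  have hq0 := hqq.pos
  have hq'0 := hqq.symm.pos
  have hq1 := hqq.sub_one_pos
  -- The extremal function in Hölder is `c * h ^ (q - 1)`; since `(q - 1) * q' = q`, this `c` gives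
  -- it norm one.
  set c := N ^ (-(1 / q')) with hc
  have hpow : c ^ q' = N⁻¹ := by
    rw [hc, ← ENNReal.rpow_mul, neg_mul, one_div_mul_cancel hq'0.ne', ENNReal.rpow_neg_one]
  have hg := hC (fun x => c * h x ^ (q - 1)) ((hh.pow_const _).const_mul _) (by
    simp only [ENNReal.mul_rpow_of_nonneg _ _ hq'0.le, ← ENNReal.rpow_mul, hqq.sub_one_mul_conj]
    rw [lintegral_const_mul _ (hh.pow_const _), hpow, ← hN, ENNReal.inv_mul_cancel h0 hfin])
  have e : ∀ x, h x * (c * h x ^ (q - 1)) = c * h x ^ q := by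
    intro x
    have : h x ^ q = h x ^ (1 : ℝ) * h x ^ (q - 1) := by
      rw [← ENNReal.rpow_add_of_nonneg _ _ zero_le_one hq1.le, add_sub_cancel]
    rw [this, ENNReal.rpow_one]; ring
  simp only [e] at hg
  rw [lintegral_const_mul _ (hh.pow_const _), ← hN] at hg
  refine le_rpow_of_le_mul_rpow hqq hfin ?_
  calc N = c * N * N ^ (1 / q') := by
        rw [mul_right_comm, hc, ← ENNReal.rpow_add _ _ h0 hfin, neg_add_cancel, ENNReal.rpow_zero,
          one_mul]
    _ ≤ C * N ^ (1 / q') := by gcongr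

/-! ### The bilinear estimate for cubes and the norm of the sparse operator -/

section Main

variable {d : ℕ}

/-- The local characteristic as a function of the underlying set. -/
def setChar (σ : (Fin d → ℝ) → ℝ) (s : Set (Fin d → ℝ)) : ℝ≥0∞ :=
  (∫⁻ x in s, maximalFunction (s.indicator σ) x) / weightMeasure σ s

/-- The Carleson constant of a `lam`-sparse family. -/
def carlesonConst (lam : ℝ) (ε : ℝ → ℝ) : ℝ≥0∞ :=
  2 * (1 - ENNReal.ofReal lam)⁻¹ * ∑' r : ℕ, (ENNReal.ofReal (ε (2 ^ r)))⁻¹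

theorem carlesonConst_ne_top {lam : ℝ} (hlam : lam < 1) {ε : ℝ → ℝ}
    (hε_pos : ∀ t, 1 ≤ t → 0 < ε t) (hε_sum : Summable fun r : ℕ => (ε (2 ^ r))⁻¹) :
    carlesonConst lam ε ≠ ⊤ := by
  have h : ∑' r : ℕ, (ENNReal.ofReal (ε (2 ^ r)))⁻¹ ≠ ⊤ := by
    have e : ∀ r : ℕ, (ENNReal.ofReal (ε (2 ^ r)))⁻¹ = ENNReal.ofReal (ε (2 ^ r))⁻¹ := fun r =>
      (ENNReal.ofReal_inv_of_pos (hε_pos _ (one_le_pow₀ one_le_two))).symm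
    simp only [e]
    exact hε_sum.tsum_ofReal_ne_top
  exact ENNReal.mul_ne_top (ENNReal.mul_ne_top ENNReal.ofNat_ne_top
    (inv_one_sub_ne_top (ENNReal.ofReal_lt_one.2 hlam))) h

/-- The majorant on `R` is the maximal function of `σ 1_R`: it exceeds `σ(Q) / |Q|` on every `Q ⊆
R`, and its integral over `R` is the local characteristic times `σ(R)` by definition. -/
theorem IsSparse.sum_weightMeasure_div_bump_le (hd : 0 < d) {lam : ℝ} {S : Set (Cube d)}
    (hS : IsSparse lam S) {ε : ℝ → ℝ} (hε_pos : ∀ t, 1 ≤ t → 0 < ε t)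
    (hε_mono : MonotoneOn ε (Set.Ici 1)) {σ : (Fin d → ℝ) → ℝ} (hσ : IsWeight σ)
    {F : Finset (Cube d)} (hF : ↑F ⊆ S) (h0 : ∀ Q ∈ F, weightMeasure σ Q.toSet ≠ 0)
    (hb : ∀ Q ∈ F, bump ε (localChar Q σ) ≠ ⊤) (R : Set (Fin d → ℝ)) :
    ∑ Q ∈ F.image Cube.toSet with Q ⊆ R, weightMeasure σ Q / bump ε (setChar σ Q) ≤
      carlesonConst lam ε * weightMeasure σ R := by
  refine sum_measure_div_le (hS.isNested hF) (μ := volume)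
    (ENNReal.ofReal_lt_one.2 hS.lt_one) (hS.volume_biUnion_le hd hF) ?_ ?_ (setChar σ)
    (fun s => maximalFunction (s.indicator σ)) ?_ ?_ _ (fun r => ENNReal.ofReal (ε (2 ^ r))) ?_ R
  all_goals simp only [Finset.mem_image]
  · rintro _ ⟨Q, -, rfl⟩
    exact Q.volume_ne_zero
  · rintro _ ⟨Q, -, rfl⟩
    exact Q.volume_ne_top
  · rintro _ ⟨Q, -, rfl⟩ _ ⟨P, -, rfl⟩ hPQ x hx
    rw [← hσ.avg_indicator hPQ]
    exact le_iSup₂ (f := fun (P : Cube d) (_ : x ∈ P.toSet) => avg (Q.toSet.indicator σ) P) P hx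
  · rintro _ ⟨Q, hQ, rfl⟩
    rw [setChar, ENNReal.div_mul_cancel (h0 Q hQ) (hσ.weightMeasure_ne_top Q)]
  · rintro _ ⟨Q, hQ, rfl⟩
    exact (bump_spec hε_pos hε_mono (hσ.one_le_localChar (h0 Q hQ)) (hb Q hQ)).2

/-- The ratio of the coefficients `|Q|^{α/d - 1}` along inclusions. -/
theorem volume_rpow_le {θ : ℝ} (hθ : 0 < θ) {lam u v : ℝ≥0∞} (hlam : lam ≠ 0) (hlam' : lam ≠ ⊤)
    (h : u ≤ lam * v) : v ^ (-θ) ≤ lam ^ θ * u ^ (-θ) := by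
  have h1 : u ^ θ ≤ lam ^ θ * v ^ θ := by
    rw [← ENNReal.mul_rpow_of_nonneg _ _ hθ.le]
    exact ENNReal.rpow_le_rpow h hθ.le
  have hl0 : lam ^ θ ≠ 0 := by simp [hlam, hlam']
  have hlt : lam ^ θ ≠ ⊤ := by simp [hlam, hlam']
  rw [ENNReal.rpow_neg, ENNReal.rpow_neg]
  calc (v ^ θ)⁻¹ = lam ^ θ * (lam ^ θ * v ^ θ)⁻¹ := by
        rw [ENNReal.mul_inv (Or.inl hl0) (Or.inl hlt), ← mul_assoc,
          ENNReal.mul_inv_cancel hl0 hlt, one_mul]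
    _ ≤ _ := by gcongr

theorem ne_top_of_mul_rpow_ne_top {A B : ℝ≥0∞} {r : ℝ} (hr : 0 < r) (hA : A ≠ 0)
    (h : A * B ^ r ≠ ⊤) : B ≠ ⊤ := by
  rintro rfl
  rw [ENNReal.top_rpow_of_pos hr, ENNReal.mul_top hA] at h
  exact h rfl

/-- The bilinear estimate for finite subfamilies of a sparse family. -/
theorem IsSparse.sum_pairing_le (hd : 0 < d) {p q α lam : ℝ} (hp : 1 < p) (hpq : p < q)
    (hαd : α < d) {S : Set (Cube d)} (hS : IsSparse lam S) {ε : ℝ → ℝ}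
    (hε_pos : ∀ t, 1 ≤ t → 0 < ε t) (hε_mono : MonotoneOn ε (Set.Ici 1))
    {σ w : (Fin d → ℝ) → ℝ} (hσ : IsWeight σ) (hw : IsWeight w)
    (hE : entropyConst p q α ε σ w ≠ ⊤) (hE' : entropyConstStar p q α ε σ w ≠ ⊤)
    {F : Finset (Cube d)} (hF : ↑F ⊆ S) {f g : (Fin d → ℝ) → ℝ≥0∞} (hf : Measurable f)
    (hg : Measurable g) (hf1 : ∫⁻ x, f x ^ p ∂weightMeasure σ ≤ 1)
    (hg1 : ∫⁻ x, g x ^ q.conjExponent ∂weightMeasure w ≤ 1) :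
    ∑ Q ∈ F, volume Q.toSet ^ (-(1 - α / d)) * (∫⁻ x in Q.toSet, f x ∂weightMeasure σ) *
        (∫⁻ x in Q.toSet, g x ∂weightMeasure w) ≤
      bilinearConst (ENNReal.ofReal lam ^ (1 - α / d)) (carlesonConst lam ε) p q *
          entropyConst p q α ε σ w +
        bilinearConst (ENNReal.ofReal lam ^ (1 - α / d)) (carlesonConst lam ε) q.conjExponent
          p.conjExponent * entropyConstStar p q α ε σ w := by
  have hpp := Real.HolderConjugate.conjExponent hp
  have hqq := Real.HolderConjugate.conjExponent (hp.trans hpq)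
  have hd0 : (0 : ℝ) < d := by exact_mod_cast hd
  have hθ : 0 < 1 - α / d := by rw [sub_pos, div_lt_one hd0]; exact hαd
  have hlam0 : ENNReal.ofReal lam ≠ 0 := (ENNReal.ofReal_pos.2 hS.pos).ne'
  have hκ : ENNReal.ofReal lam ^ (1 - α / d) < 1 :=
    ENNReal.rpow_lt_one (ENNReal.ofReal_lt_one.2 hS.lt_one) hθ
  -- Cubes of zero mass for either weight contribute nothing to the pairing, and are dropped because
  -- the averages divide by these masses.
  set G := F.filter fun Q => weightMeasure σ Q.toSet ≠ 0 ∧ weightMeasure w Q.toSet ≠ 0 with hG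
  have hGS : (↑G : Set (Cube d)) ⊆ S := (Finset.coe_subset.2 (Finset.filter_subset _ _)).trans hF
  have hσ0 : ∀ Q ∈ G, weightMeasure σ Q.toSet ≠ 0 := fun Q hQ => (Finset.mem_filter.1 hQ).2.1
  have hw0 : ∀ Q ∈ G, weightMeasure w Q.toSet ≠ 0 := fun Q hQ => (Finset.mem_filter.1 hQ).2.2
  set a : Set (Fin d → ℝ) → ℝ≥0∞ := fun s => volume s ^ (-(1 - α / d)) with ha
  have hapq : ∀ Q : Cube d, a Q.toSet * weightMeasure σ Q.toSet ^ (1 / p.conjExponent) *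
      weightMeasure w Q.toSet ^ (1 / q) = apq p q α σ w Q := by
    intro Q
    rw [apq, Cube.vol, ha, div_eq_mul_inv (_ * _), ← ENNReal.rpow_neg]
    ring
  have ha0 : ∀ Q : Cube d, a Q.toSet ≠ 0 := fun Q =>
    (ENNReal.rpow_pos (pos_iff_ne_zero.2 Q.volume_ne_zero) Q.volume_ne_top).ne'
  have hat : ∀ Q : Cube d, a Q.toSet ≠ ⊤ := fun Q => by
    simp only [ha, ne_eq, ENNReal.rpow_eq_top_iff, Q.volume_ne_zero, Q.volume_ne_top, false_and,
      or_self, not_false_eq_true]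
  have hapq0 : ∀ Q ∈ G, apq p q α σ w Q ≠ 0 := by
    intro Q hQ
    rw [← hapq]
    exact mul_ne_zero (mul_ne_zero (ha0 Q)
      (ENNReal.rpow_pos (pos_iff_ne_zero.2 (hσ0 Q hQ)) (hσ.weightMeasure_ne_top Q)).ne')
      (ENNReal.rpow_pos (pos_iff_ne_zero.2 (hw0 Q hQ)) (hw.weightMeasure_ne_top Q)).ne'
  have hEQ : ∀ Q : Cube d, apq p q α σ w Q * bump ε (localChar Q σ) ^ (1 / q) ≤
      entropyConst p q α ε σ w := fun Q => le_iSup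
        (fun Q => apq p q α σ w Q * bump ε (localChar Q σ) ^ (1 / q)) Q
  have hEQstar : ∀ Q : Cube d, apq p q α σ w Q * bump ε (localChar Q w) ^ (1 / p.conjExponent) ≤
      entropyConstStar p q α ε σ w := fun Q => le_iSup
        (fun Q => apq p q α σ w Q * bump ε (localChar Q w) ^ (1 / p.conjExponent)) Q
  -- A finite entropy constant and a nonzero coefficient force the bump, and hence the local
  -- characteristic, to be finite on `G`.
  have hbσ : ∀ Q ∈ G, bump ε (localChar Q σ) ≠ ⊤ := fun Q hQ =>
    ne_top_of_mul_rpow_ne_top (one_div_pos.2 hqq.pos) (hapq0 Q hQ)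
      (ne_top_of_le_ne_top hE (hEQ Q))
  have hbw : ∀ Q ∈ G, bump ε (localChar Q w) ≠ ⊤ := fun Q hQ =>
    ne_top_of_mul_rpow_ne_top (one_div_pos.2 hpp.symm.pos) (hapq0 Q hQ)
      (ne_top_of_le_ne_top hE' (hEQstar Q))
  have hsum : ∑ Q ∈ F, a Q.toSet * (∫⁻ x in Q.toSet, f x ∂weightMeasure σ) *
        (∫⁻ x in Q.toSet, g x ∂weightMeasure w) =
      ∑ s ∈ G.image Cube.toSet, a s * (∫⁻ x in s, f x ∂weightMeasure σ) *
        (∫⁻ x in s, g x ∂weightMeasure w) := by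
    rw [Finset.sum_image fun P _ Q _ h => Cube.toSet_injective hd h]
    refine (Finset.sum_subset (Finset.filter_subset _ _) fun Q hQ hQ' => ?_).symm
    have h : weightMeasure σ Q.toSet = 0 ∨ weightMeasure w Q.toSet = 0 := by
      by_contra! h
      exact hQ' (Finset.mem_filter.2 ⟨hQ, h⟩)
    rcases h with h | h
    · rw [setLIntegral_measure_zero _ f h, mul_zero, zero_mul]
    · rw [setLIntegral_measure_zero _ g h, mul_zero]
  rw [hsum]
  refine bilinear_le hpp hqq hpq hκ (hS.isNested hGS) _ _ hf hg a
    (fun s => bump ε (setChar σ s)) (fun s => bump ε (setChar w s)) ?_ ?_ ?_ ?_ ?_ ?_ ?_ ?_ ?_ ?_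
    ?_ ?_ ?_ (fun R _ => hS.sum_weightMeasure_div_bump_le hd hε_pos hε_mono hσ hGS hσ0 hbσ R)
    (fun R _ => hS.sum_weightMeasure_div_bump_le hd hε_pos hε_mono hw hGS hw0 hbw R) hf1 hg1
  all_goals simp only [Finset.mem_image]
  · rintro _ ⟨Q, -, rfl⟩
    exact ha0 Q
  · rintro _ ⟨Q, -, rfl⟩
    exact hat Q
  · rintro _ ⟨P, hP, rfl⟩ _ ⟨Q, hQ, rfl⟩ hPQ
    exact volume_rpow_le hθ hlam0 ENNReal.ofReal_ne_top (hS.volume_le (hGS hP) (hGS hQ) hPQ)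
  · rintro _ ⟨Q, hQ, rfl⟩
    exact hσ0 Q hQ
  · rintro _ ⟨Q, -, rfl⟩
    exact hσ.weightMeasure_ne_top Q
  · rintro _ ⟨Q, hQ, rfl⟩
    exact hw0 Q hQ
  · rintro _ ⟨Q, -, rfl⟩
    exact hw.weightMeasure_ne_top Q
  · rintro _ ⟨Q, hQ, rfl⟩
    exact (bump_spec hε_pos hε_mono (hσ.one_le_localChar (hσ0 Q hQ)) (hbσ Q hQ)).1
  · rintro _ ⟨Q, hQ, rfl⟩
    exact hbσ Q hQ
  · rintro _ ⟨Q, hQ, rfl⟩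
    exact (bump_spec hε_pos hε_mono (hw.one_le_localChar (hw0 Q hQ)) (hbw Q hQ)).1
  · rintro _ ⟨Q, hQ, rfl⟩
    exact hbw Q hQ
  · rintro _ ⟨Q, -, rfl⟩
    rw [hapq]
    exact hEQ Q
  · rintro _ ⟨Q, -, rfl⟩
    rw [hapq]
    exact hEQstar Q

/-- A pairing estimate for all finite subfamilies bounds the `L^q` norm of the sparse operator. -/
theorem lintegral_sparseOp_rpow_le {p q α : ℝ} (hp : 1 < p) (hq : 1 < q)
    {S : Set (Cube d)} (hSc : S.Countable) {σ w : (Fin d → ℝ) → ℝ} (hσ : IsWeight σ)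
    (hw : IsWeight w) {f : (Fin d → ℝ) → ℝ} {φ : (Fin d → ℝ) → ℝ≥0∞} (hφ : Measurable φ)
    (hfφ : (fun x => ‖f x‖ₑ) =ᵐ[weightMeasure σ] φ)
    (hφt : ∫⁻ x, φ x ^ p ∂weightMeasure σ ≠ ⊤) {C : ℝ≥0∞}
    (hC : ∀ F : Finset (Cube d), ↑F ⊆ S → ∀ g : (Fin d → ℝ) → ℝ≥0∞, Measurable g →
      ∫⁻ x, g x ^ q.conjExponent ∂weightMeasure w ≤ 1 →
      ∑ Q ∈ F, volume Q.toSet ^ (-(1 - α / d)) * (∫⁻ x in Q.toSet, φ x ∂weightMeasure σ) *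
        (∫⁻ x in Q.toSet, g x ∂weightMeasure w) ≤ C) :
    ∫⁻ x, sparseOp α S (fun x => σ x * f x) x ^ q ∂weightMeasure w ≤ C ^ q := by
  have hpp := Real.HolderConjugate.conjExponent hp
  have hqq := Real.HolderConjugate.conjExponent hq
  have hq0 : 0 < q := hqq.pos
  set c : Cube d → ℝ≥0∞ := fun Q =>
    volume Q.toSet ^ (-(1 - α / d)) * ∫⁻ x in Q.toSet, φ x ∂weightMeasure σ with hc
  have hct : ∀ Q, c Q ≠ ⊤ := by
    intro Q
    refine ENNReal.mul_ne_top ?_ (setLIntegral_ne_top_of_rpow hpp hφ hφt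
      (hσ.weightMeasure_ne_top Q))
    simp only [ne_eq, ENNReal.rpow_eq_top_iff, Q.volume_ne_zero, Q.volume_ne_top, false_and,
      or_self, not_false_eq_true]
  have hcoef : ∀ Q : Cube d, Q.vol ^ (α / d) * avg (fun x => σ x * f x) Q = c Q := by
    intro Q
    simp only [hc]
    rw [avg, setLIntegral_enorm_mul hσ hφ hfφ, Cube.vol, neg_sub,
      ENNReal.rpow_sub _ _ Q.volume_ne_zero Q.volume_ne_top, ENNReal.rpow_one,
      div_eq_mul_inv (∫⁻ x in Q.toSet, φ x ∂weightMeasure σ),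
      div_eq_mul_inv (volume Q.toSet ^ (α / d))]
    ring
  have hm : ∀ F : Finset S, Measurable fun x =>
      ∑ Q ∈ F, (Q : Cube d).toSet.indicator (fun _ => c Q) x := fun F =>
    Finset.measurable_fun_sum _ fun Q _ => measurable_const.indicator (Q : Cube d).measurableSet
  -- The operator is a directed supremum of finite sums, so monotone convergence reduces the norm
  -- bound to finite subfamilies.
  have hop : ∀ x, sparseOp α S (fun x => σ x * f x) x ^ q =
      ⨆ F : Finset S, (∑ Q ∈ F, (Q : Cube d).toSet.indicator (fun _ => c Q) x) ^ q := by
    intro x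
    simp only [sparseOp, hcoef]
    rw [ENNReal.tsum_eq_iSup_sum]
    exact (ENNReal.orderIsoRpow q hq0).map_iSup _
  have hcS : Countable S := hSc.to_subtype
  simp only [hop]
  rw [lintegral_iSup_directed (fun F => ((hm F).pow_const q).aemeasurable)]
  · refine iSup_le fun F => rpow_lintegral_le_of_pairing hqq (hm F) ?_ fun g hg hg1 => ?_
    -- Duality requires a finite norm in advance: a finite sum is bounded and supported on a set of
    -- finite `w`-measure.
    · set U := ⋃ Q ∈ F, (Q : Cube d).toSet with hU
      have hUm : MeasurableSet U :=
        Finset.measurableSet_biUnion _ fun Q _ => (Q : Cube d).measurableSet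
      have hUt : weightMeasure w U ≠ ⊤ :=
        ((measure_biUnion_finset_le F fun Q : S => (Q : Cube d).toSet).trans_lt (ENNReal.sum_lt_top.2 fun Q _ =>
          (hw.weightMeasure_ne_top (Q : Cube d)).lt_top)).ne
      have hpt : ∀ x, (∑ Q ∈ F, (Q : Cube d).toSet.indicator (fun _ => c Q) x) ^ q ≤
          U.indicator (fun _ => (∑ Q ∈ F, c Q) ^ q) x := by
        intro x
        by_cases hx : x ∈ U
        · rw [Set.indicator_of_mem hx]
          refine ENNReal.rpow_le_rpow (Finset.sum_le_sum fun Q _ => ?_) hq0.le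
          exact Set.indicator_le_self' (fun _ _ => zero_le) x
        · have h0 : ∑ Q ∈ F, (Q : Cube d).toSet.indicator (fun _ => c Q) x = 0 := by
            refine Finset.sum_eq_zero fun Q hQ => Set.indicator_of_notMem (fun h => hx ?_) _
            exact Set.mem_biUnion (x := Q) hQ h
          rw [h0, ENNReal.zero_rpow_of_pos hq0]
          exact zero_le
      refine ne_top_of_le_ne_top ?_ (lintegral_mono hpt)
      rw [lintegral_indicator_const hUm]
      exact ENNReal.mul_ne_top (ENNReal.rpow_ne_top_of_nonneg hq0.le
        (ENNReal.sum_ne_top.2 fun Q _ => hct Q)) hUt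
    · refine le_trans (le_of_eq ?_) (hC (F.map (Function.Embedding.subtype _)) ?_ g hg hg1)
      · rw [Finset.sum_map]
        have e : ∀ x, (∑ Q ∈ F, (Q : Cube d).toSet.indicator (fun _ => c Q) x) * g x =
            ∑ Q ∈ F, (Q : Cube d).toSet.indicator (fun x => c Q * g x) x := by
          intro x
          rw [Finset.sum_mul]
          refine Finset.sum_congr rfl fun Q _ => ?_
          by_cases hx : x ∈ (Q : Cube d).toSet <;> simp [hx]
        simp only [e]
        rw [lintegral_finsetSum' F fun (Q : S) _ =>
          ((hg.const_mul _).indicator (Q : Cube d).measurableSet).aemeasurable]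
        refine Finset.sum_congr rfl fun Q _ => ?_
        rw [lintegral_indicator (Q : Cube d).measurableSet, lintegral_const_mul _ hg]
        rfl
      · intro Q hQ
        simp only [Finset.coe_map, Set.mem_image, Function.Embedding.subtype_apply] at hQ
        obtain ⟨Q', -, rfl⟩ := hQ
        exact Q'.2
  · refine Monotone.directed_le fun F G hFG x => ?_
    exact ENNReal.rpow_le_rpow (Finset.sum_le_sum_of_subset hFG) hq0.le

end Main

end EntropyBump

end

/-! ### Conclusion by normalization of `f` -/

theorem theorem1p1 (d : ℕ) (p q α lam : ℝ) (hp : 1 < p) (hpq : p < q)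
    (hα : 0 ≤ α) (hαd : α < d)
    (ε : ℝ → ℝ) (hε_pos : ∀ t, 1 ≤ t → 0 < ε t) (hε_mono : MonotoneOn ε (Set.Ici 1))
    (hε_sum : Summable fun r : ℕ => (ε (2 ^ r))⁻¹) :
    ∃ C : ℝ≥0, ∀ S : Set (EntropyBump.Cube d), EntropyBump.IsSparse lam S →
      ∀ σ w : (Fin d → ℝ) → ℝ, EntropyBump.IsWeight σ → EntropyBump.IsWeight w →
        ∀ f : (Fin d → ℝ) → ℝ,
          MemLp f (ENNReal.ofReal p) (EntropyBump.weightMeasure σ) →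
            eLpNorm (EntropyBump.sparseOp α S fun x => σ x * f x) (ENNReal.ofReal q)
                (EntropyBump.weightMeasure w) ≤
              C * (EntropyBump.entropyConst p q α ε σ w +
                  EntropyBump.entropyConstStar p q α ε σ w) *
                eLpNorm f (ENNReal.ofReal p) (EntropyBump.weightMeasure σ) := by
  open EntropyBump in
  have hp0 : 0 < p := by linarith
  have hq0 : 0 < q := by linarith
  have hd0 : (0 : ℝ) < d := hα.trans_lt hαd
  have hd : 0 < d := by exact_mod_cast hd0
  by_cases hlam : 0 < lam ∧ lam < 1
  swap
  · exact ⟨0, fun S hS => absurd ⟨hS.pos, hS.lt_one⟩ hlam⟩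
  have hpp := Real.HolderConjugate.conjExponent hp
  have hqq := Real.HolderConjugate.conjExponent (hp.trans hpq)
  have hpq' : q.conjExponent < p.conjExponent := by
    have h1 := hpp.inv_add_inv_eq_one
    have h2 := hqq.inv_add_inv_eq_one
    have h3 : q⁻¹ < p⁻¹ := (inv_lt_inv₀ hqq.pos hpp.pos).2 hpq
    exact (inv_lt_inv₀ hpp.symm.pos hqq.symm.pos).1 (by linarith)
  have hκ : ENNReal.ofReal lam ^ (1 - α / d) < 1 :=
    ENNReal.rpow_lt_one (ENNReal.ofReal_lt_one.2 hlam.2)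
      (by rw [sub_pos, div_lt_one hd0]; exact hαd)
  have hK := carlesonConst_ne_top hlam.2 hε_pos hε_sum
  set C₁ := bilinearConst (ENNReal.ofReal lam ^ (1 - α / d)) (carlesonConst lam ε) p q with hC₁
  set C₂ := bilinearConst (ENNReal.ofReal lam ^ (1 - α / d)) (carlesonConst lam ε)
    q.conjExponent p.conjExponent with hC₂
  -- The summand `1` keeps the constant nonzero, so that the right-hand side is infinite when `E +
  -- E'` is infinite and `N` is not zero.
  have hC : 1 + C₁ + C₂ ≠ ⊤ := ENNReal.add_ne_top.2 ⟨ENNReal.add_ne_top.2 ⟨ENNReal.one_ne_top,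
    bilinearConst_ne_top hκ hK hp hpq⟩, bilinearConst_ne_top hκ hK hqq.symm.lt hpq'⟩
  refine ⟨(1 + C₁ + C₂).toNNReal, fun S hS σ w hσ hw f hf => ?_⟩
  rw [ENNReal.coe_toNNReal hC]
  set E := entropyConst p q α ε σ w with hE
  set E' := entropyConstStar p q α ε σ w with hE'
  have hpO : ENNReal.ofReal p ≠ 0 := (ENNReal.ofReal_pos.2 hp0).ne'
  have hqO : ENNReal.ofReal q ≠ 0 := (ENNReal.ofReal_pos.2 hq0).ne'
  set N := eLpNorm f (ENNReal.ofReal p) (weightMeasure σ) with hN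
  have hNt : N ≠ ⊤ := hf.2.ne
  have hfm : AEMeasurable (fun x => ‖f x‖ₑ) (weightMeasure σ) := hf.1.enorm
  set φ := hfm.mk with hφdef
  have hφ : Measurable φ := hfm.measurable_mk
  have hfφ : (fun x => ‖f x‖ₑ) =ᵐ[weightMeasure σ] φ := hfm.ae_eq_mk
  have hNφ : ∫⁻ x, φ x ^ p ∂weightMeasure σ = N ^ p := by
    rw [hN, eLpNorm_eq_lintegral_rpow_enorm_toReal hpO ENNReal.ofReal_ne_top,
      ENNReal.toReal_ofReal hp0.le, ← ENNReal.rpow_mul, one_div_mul_cancel hp0.ne',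
      ENNReal.rpow_one]
    refine lintegral_congr_ae ?_
    filter_upwards [hfφ] with x hx
    rw [← hx]
  have hφt : ∫⁻ x, φ x ^ p ∂weightMeasure σ ≠ ⊤ := by
    rw [hNφ]; exact ENNReal.rpow_ne_top_of_nonneg hp0.le hNt
  rw [eLpNorm_eq_lintegral_rpow_enorm_toReal hqO ENNReal.ofReal_ne_top,
    ENNReal.toReal_ofReal hq0.le, one_div, ENNReal.rpow_inv_le_iff hq0]
  simp only [enorm_eq_self]
  -- The case `N = 0` is separate: `f` cannot be normalized, and since `⊤ * 0 = 0` an infinite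
  -- entropy constant does not make the bound trivial. All pairings vanish then.
  rcases eq_or_ne N 0 with hN0 | hN0
  · refine lintegral_sparseOp_rpow_le hp (hp.trans hpq) (hS.countable hd) hσ hw hφ hfφ hφt
      fun F _ g _ _ => ?_
    have hφ0 : φ =ᵐ[weightMeasure σ] 0 := by
      rw [hN0, ENNReal.zero_rpow_of_pos hp0, lintegral_eq_zero_iff (hφ.pow_const p)] at hNφ
      filter_upwards [hNφ] with x hx
      simpa [hp0, hp0.not_gt] using hx
    refine (Finset.sum_eq_zero fun Q _ => ?_).le.trans zero_le
    rw [lintegral_congr_ae (ae_restrict_of_ae hφ0)]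
    simp
  by_cases hEt : E + E' = ⊤
  · have h1 : (1 + C₁ + C₂) * (E + E') * N = ⊤ := by
      rw [hEt, ENNReal.mul_top, ENNReal.top_mul hN0]
      simp
    rw [h1, ENNReal.top_rpow_of_pos hq0]
    exact le_top
  obtain ⟨hEf, hEf'⟩ := ENNReal.add_ne_top.1 hEt
  refine lintegral_sparseOp_rpow_le hp (hp.trans hpq) (hS.countable hd) hσ hw hφ hfφ hφt
    fun F hF g hg hg1 => ?_
  have h := hS.sum_pairing_le hd hp hpq hαd hε_pos hε_mono hσ hw hEf hEf' hF
    (f := fun x => N⁻¹ * φ x) (hφ.const_mul _) hg (by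
      simp only [ENNReal.mul_rpow_of_nonneg _ _ hp0.le]
      rw [lintegral_const_mul _ (hφ.pow_const p), hNφ, ← ENNReal.mul_rpow_of_nonneg _ _ hp0.le,
        ENNReal.inv_mul_cancel hN0 hNt, ENNReal.one_rpow]) hg1
  simp only [lintegral_const_mul _ hφ] at h
  rw [← hC₁, ← hC₂] at h
  calc _ = N * ∑ Q ∈ F, volume Q.toSet ^ (-(1 - α / d)) *
          (N⁻¹ * ∫⁻ x in Q.toSet, φ x ∂weightMeasure σ) *
          (∫⁻ x in Q.toSet, g x ∂weightMeasure w) := by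
        rw [Finset.mul_sum]
        refine Finset.sum_congr rfl fun Q _ => ?_
        calc _ = N * N⁻¹ * (volume Q.toSet ^ (-(1 - α / d)) *
                (∫⁻ x in Q.toSet, φ x ∂weightMeasure σ) *
                (∫⁻ x in Q.toSet, g x ∂weightMeasure w)) := by
              rw [ENNReal.mul_inv_cancel hN0 hNt, one_mul]
          _ = _ := by ring
    _ ≤ N * (C₁ * E + C₂ * E') := by gcongr
    _ ≤ N * ((1 + C₁ + C₂) * E + (1 + C₁ + C₂) * E') := by
        gcongr
        · rw [add_right_comm]; exact le_add_self
        · exact le_add_self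
    _ = _ := by ring
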